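/- For a positive integer $k$ let $\mathrm{Spin}(k)$ be the spin group of Euclidean $\mathbb{R}^{k}$, with standard covering $\pi:\mathrm{Spin}(k)\to \mathrm{SO}(k)$, $\pi(x)v=xvx^{-1}$ (product in the Clifford algebra). Two finite subgroups $\Gamma_1,\Gamma_2$ of a group $G$ are called almost conjugate in $G$ if there is a bijection $\varphi:\Gamma_1\to\Gamma_2$ such that, for every $\gamma\in\Gamma_1$, the elements $\gamma$ and $\varphi(\gamma)$ are conjugate in $G$; they are conjugate in $G$ if $g\Gamma_1g^{-1}=\Gamma_2$ for some $g\in G$. Let $n\ge 1$ be an integer and put $m=35(2n-1)$. Then there are finite subgroups $\Gamma_1,\Gamma_2$ of $\mathrm{Spin}(m)$ that are almost conjugate but not conjugate in $\mathrm{Spin}(m)$. They can moreover be chosen as images $\Gamma_i=\phi_i(\mathrm{Sym}(8))$ of two homomorphisms $\phi_1,\phi_2:\mathrm{Sym}(8)\to\mathrm{Spin}(m)$ with $\pi\circ\phi_1=\pi\circ\phi_2$ such that this common representation of $\mathrm{Sym}(8)$ on $\mathbb{R}^{m}$ is isomorphic to $V\otimes\mathbb{R}^{2n-1}$, where $V$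 is the $35$-dimensional real representation (Specht module) of $\mathrm{Sym}(8)$ associated with the partition $(4,1,1,1,1)$ and $\mathrm{Sym}(8)$ acts trivially on $\mathbb{R}^{2n-1}$. -/

import Mathlib

open scoped TensorProduct

noncomputable section

/-! ### Almost conjugate and conjugate subgroups -/

/-- Two subgroups of `G` are almost conjugate in `G` if there is a bijection between them that
matches each element with an element conjugate to it in `G`. -/
def AlmostConjugate {G : Type*} [Group G] (Γ₁ Γ₂ : Subgroup G) : Prop :=
  ∃ φ : Γ₁ ≃ Γ₂, ∀ γ : Γ₁, IsConj (γ : G) (φ γ : G)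

/-- Two subgroups of `G` are conjugate in `G` if `g Γ₁ g⁻¹ = Γ₂` for some `g` in `G`. -/
def ConjugateSubgroups {G : Type*} [Group G] (Γ₁ Γ₂ : Subgroup G) : Prop :=
  ∃ g : G, Γ₁.map (MulAut.conj g).toMonoidHom = Γ₂

/-! ### Spin groups and the standard covering -/

/-- The quadratic form `v ↦ -|v|²` on `ℝᵐ`. -/
abbrev negEuclideanForm (m : ℕ) : QuadraticForm ℝ (Fin m → ℝ) :=
  QuadraticMap.weightedSumSquares ℝ (fun _ : Fin m => (-1 : ℝ))

/-- The compact group `Spin(m)`: even products of unit vectors of `ℝᵐ` in the Clifford algebra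
with `v * v = -|v|²`. -/
abbrev Spin (m : ℕ) : Type := spinGroup (negEuclideanForm m)

theorem ι_negEuclideanForm_injective (m : ℕ) :
    Function.Injective (CliffordAlgebra.ι (negEuclideanForm m)) := by
  intro v w h
  have : Invertible (2 : ℝ) := invertibleOfNonzero two_ne_zero
  have h' := congrArg (CliffordAlgebra.equivExterior (negEuclideanForm m)) h
  simp only [CliffordAlgebra.equivExterior, CliffordAlgebra.changeFormEquiv_apply,
    CliffordAlgebra.changeForm_ι] at h'
  exact (ExteriorAlgebra.ι_leftInverse (R := ℝ) (M := Fin m → ℝ)).injective h'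

theorem Spin.exists_unique_conj_ι {m : ℕ} (x : Spin m) (v : Fin m → ℝ) :
    ∃! w : Fin m → ℝ, CliffordAlgebra.ι (negEuclideanForm m) w =
      (x : CliffordAlgebra (negEuclideanForm m)) * CliffordAlgebra.ι _ v *
        ((x⁻¹ : Spin m) : CliffordAlgebra (negEuclideanForm m)) := by
  have : Invertible (2 : ℝ) := invertibleOfNonzero two_ne_zero
  have hx : ((spinGroup.toUnits x : (CliffordAlgebra (negEuclideanForm m))ˣ) :
      CliffordAlgebra (negEuclideanForm m)) ∈ spinGroup (negEuclideanForm m) := x.2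
  obtain ⟨w, hw⟩ := spinGroup.conjAct_smul_ι_mem_range_ι hx v
  refine ⟨w, hw, fun w' hw' => ι_negEuclideanForm_injective m ?_⟩
  exact hw'.trans hw.symm

/-- The vector `x v x⁻¹`, the product being taken in the Clifford algebra. -/
def Spin.act {m : ℕ} (x : Spin m) (v : Fin m → ℝ) : Fin m → ℝ :=
  (Spin.exists_unique_conj_ι x v).choose

theorem Spin.ι_act {m : ℕ} (x : Spin m) (v : Fin m → ℝ) :
    CliffordAlgebra.ι (negEuclideanForm m) (x.act v) =
      (x : CliffordAlgebra (negEuclideanForm m)) * CliffordAlgebra.ι _ v *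
        ((x⁻¹ : Spin m) : CliffordAlgebra (negEuclideanForm m)) :=
  (Spin.exists_unique_conj_ι x v).choose_spec.1

/-- The standard covering `π : Spin(m) → SO(m)`, viewed as a representation of `Spin(m)` on `ℝᵐ`:
`π(x)(v) = x v x⁻¹` in the Clifford algebra. -/
def spinCover (m : ℕ) : Representation ℝ (Spin m) (Fin m → ℝ) where
  toFun x :=
    { toFun := x.act
      map_add' := fun v w => ι_negEuclideanForm_injective m (by
        simp only [map_add, Spin.ι_act, mul_add, add_mul])
      map_smul' := fun c v => ι_negEuclideanForm_injective m (by
        simp only [map_smul, Spin.ι_act, RingHom.id_apply, mul_smul_comm, smul_mul_assoc]) }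
  map_one' := LinearMap.ext fun v => ι_negEuclideanForm_injective m (by
    simp [Spin.ι_act])
  map_mul' x y := LinearMap.ext fun v => ι_negEuclideanForm_injective m (by
    simp [Spin.ι_act, mul_inv_rev, mul_assoc])

/-! ### Specht modules -/

/-- A Young tableau of shape `μ` with entries `α`, each used once: the entry `a` stands in the
cell `t a`, whose row is `(t a).1.1` and whose column is `(t a).1.2`. -/
abbrev YoungTableau (μ : YoungDiagram) (α : Type*) : Type _ := α ≃ μ.cells

/-- The tableau `σ t`, obtained from `t` by replacing each entry `a` by `σ a`. -/
def YoungTableau.perm {μ : YoungDiagram} {α : Type*} (σ : Equiv.Perm α) (t : YoungTableau μ α) :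
    YoungTableau μ α :=
  σ.symm.trans t

/-- The function that records in which row of `t` each entry stands. Two tableaux are row
equivalent (equal up to reordering the entries inside the rows) if and only if these functions
agree. -/
def YoungTableau.row {μ : YoungDiagram} {α : Type*} (t : YoungTableau μ α) : α → ℕ :=
  fun a => (t a).1.1

/-- The tabloids of shape `μ`: the row-equivalence classes of tableaux of shape `μ`, a class being
recorded by the common row function of its members. -/
def YoungTabloid (μ : YoungDiagram) (α : Type*) : Type _ :=
  {f : α → ℕ // ∃ t : YoungTableau μ α, t.row = f}

/-- The tabloid `{t}` of a tableau `t`. -/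
def YoungTableau.tabloid {μ : YoungDiagram} {α : Type*} (t : YoungTableau μ α) :
    YoungTabloid μ α :=
  ⟨t.row, t, rfl⟩

/-- Permutations of the entries act on tabloids by `σ {t} = {σ t}`. -/
instance YoungTabloid.instMulAction (μ : YoungDiagram) (α : Type*) :
    MulAction (Equiv.Perm α) (YoungTabloid μ α) where
  smul σ f := ⟨f.1 ∘ σ.symm, by
    obtain ⟨t, ht⟩ := f.2
    exact ⟨t.perm σ, by rw [← ht]; rfl⟩⟩
  one_smul _ := rfl
  mul_smul _ _ _ := rfl

theorem YoungTableau.smul_tabloid {μ : YoungDiagram} {α : Type*} (σ : Equiv.Perm α)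
    (t : YoungTableau μ α) : σ • t.tabloid = (t.perm σ).tabloid := rfl

/-- The permutation module `M^μ`, spanned by the tabloids of shape `μ`. -/
abbrev tabloidRepresentation (μ : YoungDiagram) (α : Type*) :
    Representation ℝ (Equiv.Perm α) (MonoidAlgebra ℝ (YoungTabloid μ α)) :=
  Representation.ofMulAction ℝ (Equiv.Perm α) (YoungTabloid μ α)

/-- The column stabilizer of `t`: the permutations of the entries that preserve each column. -/
def YoungTableau.columnGroup {μ : YoungDiagram} {α : Type*} [Fintype α] [DecidableEq α]
    (t : YoungTableau μ α) :
    Finset (Equiv.Perm α) :=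
  {σ : Equiv.Perm α | ∀ a, (t (σ a)).1.2 = (t a).1.2}

/-- The polytabloid `e_t = ∑ sgn(σ) σ{t}`, summed over the column stabilizer of `t`. -/
def YoungTableau.polytabloid {μ : YoungDiagram} {α : Type*} [Fintype α] [DecidableEq α]
    (t : YoungTableau μ α) :
    MonoidAlgebra ℝ (YoungTabloid μ α) :=
  ∑ σ ∈ t.columnGroup,
    MonoidAlgebra.single (σ • t.tabloid) (((Equiv.Perm.sign σ : ℤˣ) : ℤ) : ℝ)

theorem tabloidRepresentation_polytabloid {μ : YoungDiagram} {α : Type*} [Fintype α]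
    [DecidableEq α] (σ : Equiv.Perm α) (t : YoungTableau μ α) :
    tabloidRepresentation μ α σ t.polytabloid = (t.perm σ).polytabloid := by
  simp only [YoungTableau.polytabloid, map_sum, Representation.ofMulAction_single]
  refine Finset.sum_equiv (MulAut.conj σ).toEquiv (fun τ => ?_) (fun τ _ => ?_)
  · simp only [YoungTableau.columnGroup, Finset.mem_filter, Finset.mem_univ, true_and]
    constructor
    · intro h a
      simpa [YoungTableau.perm] using h (σ.symm a)
    · intro h a
      simpa [YoungTableau.perm] using h (σ a)
  · rw [← YoungTableau.smul_tabloid]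
    have h : ((Equiv.Perm.sign σ : ℤ) : ℝ) * ((Equiv.Perm.sign σ : ℤ) : ℝ) = 1 := by
      rw [← Int.cast_mul, ← Units.val_mul, Int.units_mul_self]; simp
    simp only [MulEquiv.toEquiv_eq_coe, EquivLike.coe_coe, MulAut.conj_apply, smul_smul,
      inv_mul_cancel_right, Equiv.Perm.sign_mul, Equiv.Perm.sign_inv, Units.val_mul, Int.cast_mul]
    rw [mul_right_comm, h, one_mul]

/-- The real Specht module `S^μ` as a subrepresentation of `M^μ`: the span of the polytabloids. -/
def spechtSubrepresentation (μ : YoungDiagram) (α : Type*) [Fintype α] [DecidableEq α] :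
    Subrepresentation (tabloidRepresentation μ α) where
  toSubmodule := Submodule.span ℝ (Set.range (YoungTableau.polytabloid (μ := μ) (α := α)))
  apply_mem_toSubmodule σ v hv := by
    induction hv using Submodule.span_induction with
    | mem v hv =>
      obtain ⟨t, rfl⟩ := hv
      rw [tabloidRepresentation_polytabloid]
      exact Submodule.subset_span ⟨_, rfl⟩
    | zero => rw [map_zero]; exact Submodule.zero_mem _
    | add v w _ _ hv hw => rw [map_add]; exact Submodule.add_mem _ hv hw
    | smul c v _ hv => rw [map_smul]; exact Submodule.smul_mem _ c hv

/-- The real representation of `Sym(α)` on the Specht module `S^μ`. -/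
abbrev spechtRepresentation (μ : YoungDiagram) (α : Type*) [Fintype α] [DecidableEq α] :
    Representation ℝ (Equiv.Perm α) (spechtSubrepresentation μ α).toSubmodule :=
  (spechtSubrepresentation μ α).toRepresentation

/-- The Young diagram of the partition `(4,1,1,1,1)` of `8`. -/
def hookDiagram : YoungDiagram :=
  YoungDiagram.ofRowLens [4, 1, 1, 1, 1] (by decide)

/-- The representation `ρ ⊗ 1` of `Sym(8)` on `V ⊗ ℝᵏ`, where `ρ` on `V` is the representation of
the partition `(4,1,1,1,1)` and `Sym(8)` acts trivially on `ℝᵏ`. -/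
abbrev hookTensorTrivial (k : ℕ) : Representation ℝ (Equiv.Perm (Fin 8))
    ((spechtSubrepresentation hookDiagram (Fin 8)).toSubmodule ⊗[ℝ] (Fin k → ℝ)) :=
  (spechtRepresentation hookDiagram (Fin 8)).tprod
    (Representation.trivial ℝ (Equiv.Perm (Fin 8)) (Fin k → ℝ))

end

/-! Write `ρ` for the representation on `V` in an orthonormal basis and `k` for the multiplicity.
The two homomorphisms are a lift `φ` of `ρ ⊗ 1` to the spin group and its twist `ψ`, which
multiplies `φ σ` by the central element `-1` when `σ` is odd. They have the same projection under
the covering.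

Existence of the lift. An orthogonal involution whose `-1`-eigenspace has dimension divisible by `4`
lifts to an involution (`exists_spin_lift_of_involution`). On `V`, of dimension `35`, a
transposition and a product of two disjoint transpositions both have trace `-5`, so on `V ⊗ ℝᵏ`
their `-1`-eigenspaces have dimension `20 k`. The squares and commutations of the Coxeter
presentation therefore hold for the lifts, and the braid relations hold after a choice of signs
(`exists_spin_lift_of_representation`).

Almost conjugacy. Only odd `σ` matter, where `φ σ` has to be conjugate to `-φ σ`. An odd permutation
has both eigenvalues `1` and `-1` on `V` (`exists_hookRep_eigenvector`), and the Clifford product of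
a unit eigenvector for each conjugates one lift into the other (`Spin.isConj_of_coe_eq_neg`).

Non-conjugacy (`not_conjugate_of_spin_lift`). An element conjugating one image into the other
induces an automorphism of `Sym(8)`, which is inner (`permEight_mulEquiv_inner`). After a correction
by an element of the second image, `g` intertwines `φ` and `ψ`, so its image in the orthogonal group
commutes with `ρ ⊗ 1`. As `V` has scalar commutant, this image is `1 ⊗ B` with `B` orthogonal.
Factoring `B` into reflections shows that `g` commutes with the lift of any transposition, because a
transposition has determinant `(-1)^20 = 1` on `V` (`Spin.commute_of_tens`). Hence `φ` and `ψ` would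
agree on a transposition, which is absurd.

All facts about `V` are proved in a model inside the functions of four indices in `Fin 8`
(`hookSpace`), where a polytabloid becomes a table of `5 × 5` determinants and traces become finite
computations. `spechtEquiv` identifies the model with the Specht module. -/

noncomputable section

/-! ### The Coxeter presentation of the symmetric group -/

/-- The Coxeter relations of type `Aₙ` for `T 0, …, T (n - 1)`. -/
structure IsCoxeterFamily {G : Type*} [Group G] (n : ℕ) (T : ℕ → G) : Prop where
  sq : ∀ i < n, T i * T i = 1
  braid : ∀ i, i + 1 < n → T i * T (i + 1) * T i = T (i + 1) * T i * T (i + 1)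
  comm : ∀ i j, i + 2 ≤ j → j < n → T i * T j = T j * T i

namespace IsCoxeterFamily

variable {G : Type*} [Group G]

/-- The product `T k * T (k - 1) * ⋯ * T j` (`1` if `j = k + 1`), with `l = k + 1 - j` factors. -/
def descend (T : ℕ → G) (k : ℕ) : ℕ → G
  | 0 => 1
  | l + 1 => descend T k l * T (k - l)

theorem descend_comm {n : ℕ} {T : ℕ → G} (h : IsCoxeterFamily n T) {k : ℕ} (hk : k < n) (i : ℕ) :
    ∀ l, l ≤ k + 1 → i + l < k → descend T k l * T i = T i * descend T k l
  | 0, _, _ => by simp [descend]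
  | l + 1, hl, hi => by
    rw [descend, mul_assoc, ← h.comm i (k - l) (by omega) (by omega), ← mul_assoc,
      descend_comm h hk i l (by omega) (by omega), mul_assoc]

/-- The generator `T (i + 1)` passes the factors of small index by commutation, meets `T (i + 1) * T
i`, becomes `T i` by the braid relation, and then commutes past the factors of large index. -/
theorem descend_mul_gen {n : ℕ} {T : ℕ → G} (h : IsCoxeterFamily n T) {k : ℕ} (hk : k < n) (i : ℕ)
    (hi : i < k) : ∀ l, l ≤ k + 1 → k < i + l →
      descend T k l * T (i + 1) = T i * descend T k l
  | 0, _, h0 => by omega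
  | l + 1, hl, hil => by
    rcases Nat.lt_or_ge k (i + l) with h1 | h1
    · rw [descend, mul_assoc, h.comm (k - l) (i + 1) (by omega) (by omega), ← mul_assoc,
        descend_mul_gen h hk i hi l (by omega) h1, mul_assoc]
    · obtain ⟨l, rfl⟩ : ∃ l', l = l' + 1 := ⟨l - 1, by omega⟩
      have e1 : k - l = i + 1 := by omega
      have e2 : k - (l + 1) = i := by omega
      rw [descend, descend, e1, e2]
      calc descend T k l * T (i + 1) * T i * T (i + 1)
          = descend T k l * (T (i + 1) * T i * T (i + 1)) := by group
        _ = descend T k l * (T i * T (i + 1) * T i) := by rw [h.braid i (by omega)]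
        _ = (descend T k l * T i) * (T (i + 1) * T i) := by group
        _ = _ := by rw [descend_comm h hk i l (by omega) (by omega)]; group

/-- The subgroup generated by the first `k` members of the family. -/
def genSubgroup (T : ℕ → G) (k : ℕ) : Subgroup G := Subgroup.closure (T '' Set.Iio k)

theorem mem_genSubgroup (T : ℕ → G) {i k : ℕ} (h : i < k) : T i ∈ genSubgroup T k :=
  Subgroup.subset_closure ⟨i, h, rfl⟩

/-- The `k + 2` descending products represent all right cosets of the subgroup on the first `k`
generators. It suffices that the set of products `y * descend T k l` is stable under right
multiplication by each generator. -/
theorem exists_eq_mul_descend {n : ℕ} {T : ℕ → G} (h : IsCoxeterFamily n T) {k : ℕ} (hk : k < n)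
    {x : G} (hx : x ∈ genSubgroup T (k + 1)) :
    ∃ y ∈ genSubgroup T k, ∃ l, l < k + 2 ∧ x = y * descend T k l := by
  have step : ∀ x : G, (∃ y ∈ genSubgroup T k, ∃ l, l < k + 2 ∧ x = y * descend T k l) →
      ∀ i < k + 1, ∃ y ∈ genSubgroup T k, ∃ l, l < k + 2 ∧ x * T i = y * descend T k l := by
    rintro _ ⟨y, hy, l, hl, rfl⟩ i hi
    -- The factors of `descend T k l` have indices `k, …, k + 1 - l`. So `T i` commutes past them if
    -- `i + l < k`, prolongs the product if `i + l = k`, cancels its last factor if `i + l = k + 1`,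
    -- and otherwise comes out on the left as `T (i - 1)`.
    rcases Nat.lt_trichotomy (i + l) k with h1 | h1 | h1
    · exact ⟨y * T i, mul_mem hy (mem_genSubgroup T (by omega)), l, hl, by
        rw [mul_assoc, descend_comm h hk i l (by omega) h1, mul_assoc]⟩
    · exact ⟨y, hy, l + 1, by omega, by
        rw [descend, mul_assoc, show k - l = i by omega]⟩
    · rcases Nat.lt_or_ge (k + 1) (i + l) with h2 | h2
      · obtain ⟨i, rfl⟩ : ∃ i', i = i' + 1 := ⟨i - 1, by omega⟩
        exact ⟨y * T i, mul_mem hy (mem_genSubgroup T (by omega)), l, hl, by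
          rw [mul_assoc, descend_mul_gen h hk i (by omega) l (by omega) (by omega), mul_assoc]⟩
      · obtain ⟨l, rfl⟩ : ∃ l', l = l' + 1 := ⟨l - 1, by omega⟩
        refine ⟨y, hy, l, by omega, ?_⟩
        rw [descend, show k - l = i by omega, mul_assoc, mul_assoc, h.sq i (by omega), mul_one]
  induction hx using Subgroup.closure_induction_right with
  | one => exact ⟨1, one_mem _, 0, by omega, by simp [descend]⟩
  | mul_right x _ y hy ih =>
    obtain ⟨i, hi, rfl⟩ := hy
    exact step _ ih i hi
  | mul_inv_cancel x _ y hy ih =>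
    obtain ⟨i, hi, rfl⟩ := hy
    rw [inv_eq_of_mul_eq_one_left (h.sq i (by have : i < k + 1 := hi; omega))]
    exact step _ ih i hi

theorem card_genSubgroup_le {n : ℕ} {T : ℕ → G} (h : IsCoxeterFamily n T) :
    ∀ k ≤ n, Finite (genSubgroup T k) ∧ Nat.card (genSubgroup T k) ≤ (k + 1).factorial
  | 0, _ => by
    have : genSubgroup T 0 = ⊥ := by simp [genSubgroup]
    rw [this]
    exact ⟨inferInstance, by simp⟩
  | k + 1, hk => by
    obtain ⟨hf, hc⟩ := card_genSubgroup_le h k (by omega)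
    choose y hy l hl e using fun x : genSubgroup T (k + 1) =>
      exists_eq_mul_descend h (by omega) x.2
    let f : genSubgroup T (k + 1) → genSubgroup T k × Fin (k + 2) :=
      fun x => (⟨y x, hy x⟩, ⟨l x, hl x⟩)
    have hinj : Function.Injective f := by
      intro a b hab
      simp only [f, Prod.mk.injEq, Subtype.mk.injEq, Fin.mk.injEq] at hab
      exact Subtype.ext (by rw [e a, e b, hab.1, hab.2])
    refine ⟨Finite.of_injective f hinj, (Nat.card_le_card_of_injective f hinj).trans ?_⟩
    rw [Nat.card_prod, Nat.card_fin, Nat.factorial_succ (k + 1), mul_comm]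
    exact Nat.mul_le_mul_left _ hc

end IsCoxeterFamily

/-- The adjacent transposition `(i, i + 1)` of `Fin (n + 1)` (the identity if `i ≥ n`). -/
def adjacentSwap (n i : ℕ) : Equiv.Perm (Fin (n + 1)) :=
  if h : i < n then Equiv.swap ⟨i, by omega⟩ ⟨i + 1, by omega⟩ else 1

theorem adjacentSwap_of_lt {n i : ℕ} (h : i < n) :
    adjacentSwap n i = Equiv.swap ⟨i, by omega⟩ ⟨i + 1, by omega⟩ := dif_pos h

theorem swap_braid {α : Type*} [DecidableEq α] {a b c : α} (hab : a ≠ b) (hbc : b ≠ c)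
    (hac : a ≠ c) : Equiv.swap a b * Equiv.swap b c * Equiv.swap a b =
      Equiv.swap b c * Equiv.swap a b * Equiv.swap b c := by
  rw [Equiv.swap_mul_swap_mul_swap hab hac, Equiv.swap_comm a b, Equiv.swap_comm b c,
    Equiv.swap_mul_swap_mul_swap hbc.symm hac.symm, Equiv.swap_comm]

theorem isCoxeterFamily_adjacentSwap (n : ℕ) : IsCoxeterFamily n (adjacentSwap n) where
  sq i hi := by rw [adjacentSwap_of_lt hi, Equiv.swap_mul_self]
  braid i hi := by
    rw [adjacentSwap_of_lt hi, adjacentSwap_of_lt (by omega : i < n)]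
    exact swap_braid (by simp) (by simp) (by simp [Fin.ext_iff]; omega)
  comm i j hij hj := by
    rw [adjacentSwap_of_lt hj, adjacentSwap_of_lt (by omega : i < n)]
    refine (Equiv.Perm.disjoint_swap_swap ?_).commute.eq
    simp [Fin.ext_iff]; omega

theorem closure_adjacentSwap (n : ℕ) :
    Subgroup.closure (adjacentSwap n '' Set.Iio n) = ⊤ := by
  have h := Equiv.Perm.mclosure_swap_castSucc_succ n
  rw [eq_top_iff]
  intro x _
  have hx : x ∈ Submonoid.closure
      (Set.range fun i : Fin n => Equiv.swap i.castSucc i.succ) := by rw [h]; trivial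
  rw [← Subgroup.mem_toSubmonoid, Subgroup.closure_toSubmonoid]
  refine Submonoid.closure_mono ?_ hx
  rintro _ ⟨i, rfl⟩
  exact Or.inl ⟨i, i.2, adjacentSwap_of_lt i.2⟩

/-- Elements satisfying the Coxeter relations of type `Aₙ` define a homomorphism from the
symmetric group. -/
theorem IsCoxeterFamily.exists_hom {G : Type*} [Group G] {n : ℕ} {T : ℕ → G}
    (h : IsCoxeterFamily n T) :
    ∃ φ : Equiv.Perm (Fin (n + 1)) →* G, ∀ i < n, φ (adjacentSwap n i) = T i := by
  -- The subgroup generated by the pairs has at most `(n + 1)!` elements and projects onto the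
  -- symmetric group, so the projection is bijective and the subgroup is the graph of the wanted
  -- homomorphism.
  let S : ℕ → G × Equiv.Perm (Fin (n + 1)) := fun i => (T i, adjacentSwap n i)
  have hs := isCoxeterFamily_adjacentSwap n
  have hS : IsCoxeterFamily n S :=
    ⟨fun i hi => Prod.ext (h.sq i hi) (hs.sq i hi),
      fun i hi => Prod.ext (h.braid i hi) (hs.braid i hi),
      fun i j hij hj => Prod.ext (h.comm i j hij hj) (hs.comm i j hij hj)⟩
  obtain ⟨hf, hc⟩ := hS.card_genSubgroup_le n le_rfl
  let H := genSubgroup S n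
  let p : H →* Equiv.Perm (Fin (n + 1)) := (MonoidHom.snd _ _).comp H.subtype
  have hsurj : Function.Surjective p := by
    rw [← MonoidHom.range_eq_top, eq_top_iff, ← closure_adjacentSwap n, Subgroup.closure_le]
    rintro _ ⟨i, hi, rfl⟩
    exact ⟨⟨S i, mem_genSubgroup S hi⟩, rfl⟩
  have hbij : Function.Bijective p := by
    rw [Nat.bijective_iff_surjective_and_card]
    refine ⟨hsurj, le_antisymm ?_ (Nat.card_le_card_of_surjective p hsurj)⟩
    rwa [Nat.card_perm, Nat.card_fin]
  let e : H ≃* Equiv.Perm (Fin (n + 1)) := MulEquiv.ofBijective p hbij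
  refine ⟨((MonoidHom.fst _ _).comp H.subtype).comp e.symm.toMonoidHom, fun i hi => ?_⟩
  have : e.symm (adjacentSwap n i) = ⟨S i, mem_genSubgroup S hi⟩ := by
    rw [MulEquiv.symm_apply_eq]; rfl
  change (MonoidHom.fst _ _) (H.subtype (e.symm (adjacentSwap n i))) = T i
  rw [this]; rfl

/-! ### Clifford products of orthonormal vectors -/

/-- The generators of the Clifford algebra containing `Spin m`. -/
abbrev cvec {m : ℕ} : (Fin m → ℝ) →ₗ[ℝ] CliffordAlgebra (negEuclideanForm m) :=
  CliffordAlgebra.ι (negEuclideanForm m)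

theorem negEuclideanForm_apply {m : ℕ} (v : Fin m → ℝ) : negEuclideanForm m v = -(v ⬝ᵥ v) := by
  simp [negEuclideanForm, QuadraticMap.weightedSumSquares_apply, dotProduct]

theorem polar_negEuclideanForm {m : ℕ} (v w : Fin m → ℝ) :
    QuadraticMap.polar (negEuclideanForm m) v w = -(2 * (v ⬝ᵥ w)) := by
  simp only [QuadraticMap.polar, negEuclideanForm_apply, add_dotProduct, dotProduct_add,
    dotProduct_comm w v]
  ring

theorem cvec_mul_self {m : ℕ} (v : Fin m → ℝ) :
    cvec v * cvec v = algebraMap ℝ _ (-(v ⬝ᵥ v)) := by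
  rw [cvec, CliffordAlgebra.ι_sq_scalar, negEuclideanForm_apply]

theorem cvec_mul_self_of_unit {m : ℕ} {v : Fin m → ℝ} (h : v ⬝ᵥ v = 1) :
    cvec v * cvec v = -1 := by
  rw [cvec_mul_self, h, map_neg, map_one]

theorem cvec_mul_comm {m : ℕ} (v w : Fin m → ℝ) :
    cvec v * cvec w = -(cvec w * cvec v) - (2 * (v ⬝ᵥ w)) • 1 := by
  rw [eq_sub_iff_add_eq, eq_neg_iff_add_eq_zero, add_right_comm, CliffordAlgebra.ι_mul_ι_add_swap,
    polar_negEuclideanForm, map_neg, ← Algebra.algebraMap_eq_smul_one, neg_add_cancel]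

theorem cvec_mul_comm_of_ortho {m : ℕ} {v w : Fin m → ℝ} (h : v ⬝ᵥ w = 0) :
    cvec v * cvec w = -(cvec w * cvec v) := by
  rw [cvec_mul_comm, h, mul_zero, zero_smul, sub_zero]

theorem cvec_mem_pinGroup {m : ℕ} {v : Fin m → ℝ} (h : v ⬝ᵥ v = 1) :
    cvec v ∈ pinGroup (negEuclideanForm m) := by
  have h1 := cvec_mul_self_of_unit h
  let u : (CliffordAlgebra (negEuclideanForm m))ˣ :=
    ⟨cvec v, -cvec v, by rw [mul_neg, h1, neg_neg], by rw [neg_mul, h1, neg_neg]⟩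
  refine ⟨⟨u, Subgroup.subset_closure ⟨v, rfl⟩, rfl⟩, ?_⟩
  rw [SetLike.mem_coe, Unitary.mem_iff]
  have : star (cvec v) = -cvec v := by
    simp [CliffordAlgebra.star_def, CliffordAlgebra.involute_ι]
  rw [this]
  exact ⟨by rw [neg_mul, h1, neg_neg], by rw [mul_neg, h1, neg_neg]⟩

/-- A list of orthonormal vectors. -/
def IsOrthonormalList {m : ℕ} (l : List (Fin m → ℝ)) : Prop :=
  (∀ v ∈ l, v ⬝ᵥ v = 1) ∧ l.Pairwise (fun v w => v ⬝ᵥ w = 0)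

/-- The Clifford product of a list of vectors. -/
def cprod {m : ℕ} (l : List (Fin m → ℝ)) : CliffordAlgebra (negEuclideanForm m) :=
  (l.map cvec).prod

@[simp]
theorem cprod_nil {m : ℕ} : cprod ([] : List (Fin m → ℝ)) = 1 := rfl

@[simp]
theorem cprod_cons {m : ℕ} (v : Fin m → ℝ) (l : List (Fin m → ℝ)) :
    cprod (v :: l) = cvec v * cprod l := List.prod_cons

theorem cprod_mem_evenOdd {m : ℕ} (l : List (Fin m → ℝ)) :
    cprod l ∈ CliffordAlgebra.evenOdd (negEuclideanForm m) (l.length : ZMod 2) := by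
  induction l with
  | nil => exact Submodule.one_le.1 (CliffordAlgebra.one_le_evenOdd_zero _)
  | cons v l ih =>
    rw [cprod_cons, List.length_cons, Nat.cast_add, Nat.cast_one, add_comm]
    exact CliffordAlgebra.evenOdd_mul_le _ _ _
      (Submodule.mul_mem_mul (CliffordAlgebra.ι_mem_evenOdd_one _ v) ih)

theorem cprod_mem_pinGroup {m : ℕ} {l : List (Fin m → ℝ)} (h : ∀ v ∈ l, v ⬝ᵥ v = 1) :
    cprod l ∈ pinGroup (negEuclideanForm m) := by
  induction l with
  | nil => exact one_mem _
  | cons v l ih =>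
    rw [cprod_cons]
    exact mul_mem (cvec_mem_pinGroup (h v List.mem_cons_self))
      (ih fun w hw => h w (List.mem_cons_of_mem v hw))

theorem cprod_mem_spinGroup {m : ℕ} {l : List (Fin m → ℝ)} (h : ∀ v ∈ l, v ⬝ᵥ v = 1)
    (he : Even l.length) : cprod l ∈ spinGroup (negEuclideanForm m) := by
  refine ⟨cprod_mem_pinGroup h, ?_⟩
  have := cprod_mem_evenOdd l
  rw [(ZMod.natCast_eq_zero_iff_even).2 he] at this
  exact this

theorem cprod_mul_cvec_of_ortho {m : ℕ} {l : List (Fin m → ℝ)} {w : Fin m → ℝ}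
    (h : ∀ v ∈ l, v ⬝ᵥ w = 0) :
    cprod l * cvec w = (-1 : ℝ) ^ l.length • (cvec w * cprod l) := by
  induction l with
  | nil => simp
  | cons v l ih =>
    rw [cprod_cons, mul_assoc, ih fun u hu => h u (List.mem_cons_of_mem v hu), mul_smul_comm,
      ← mul_assoc, cvec_mul_comm_of_ortho (h v List.mem_cons_self), List.length_cons, pow_succ,
      neg_mul, mul_assoc, smul_neg, mul_neg_one, neg_smul]

theorem IsOrthonormalList.of_cons {m : ℕ} {v : Fin m → ℝ} {l : List (Fin m → ℝ)}
    (h : IsOrthonormalList (v :: l)) : v ⬝ᵥ v = 1 ∧ (∀ w ∈ l, v ⬝ᵥ w = 0) ∧ IsOrthonormalList l :=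
  ⟨h.1 v List.mem_cons_self, (List.pairwise_cons.1 h.2).1,
    fun w hw => h.1 w (List.mem_cons_of_mem v hw), (List.pairwise_cons.1 h.2).2⟩

theorem cprod_mul_cvec_of_mem {m : ℕ} {l : List (Fin m → ℝ)} (hl : IsOrthonormalList l)
    {w : Fin m → ℝ} (h : w ∈ l) :
    cprod l * cvec w = -((-1 : ℝ) ^ l.length • (cvec w * cprod l)) := by
  induction l with
  | nil => simp at h
  | cons v l ih =>
    obtain ⟨hv, ho, hl'⟩ := hl.of_cons
    rw [List.length_cons, pow_succ, mul_neg_one, neg_smul, neg_neg, cprod_cons]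
    rcases List.mem_cons.1 h with rfl | hw
    · rw [mul_assoc, cprod_mul_cvec_of_ortho fun u hu => by rw [dotProduct_comm]; exact ho u hu,
        mul_smul_comm]
    · rw [mul_assoc, ih hl' hw, mul_neg, mul_smul_comm, ← mul_assoc,
        cvec_mul_comm_of_ortho (ho w hw), neg_mul, smul_neg, neg_neg, mul_assoc]

/-- With `p` vectors, regrouping the square costs `p (p - 1) / 2` transpositions, and each of the
`p` squares contributes `-1`. The sign is `1` when `4` divides `p`, which is the source of the
divisibility conditions below. -/
theorem cprod_mul_self {m : ℕ} {l : List (Fin m → ℝ)} (hl : IsOrthonormalList l) :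
    cprod l * cprod l = (-1 : ℝ) ^ (l.length * (l.length + 1) / 2) • 1 := by
  induction l with
  | nil => simp
  | cons v l ih =>
    obtain ⟨hv, ho, hl'⟩ := hl.of_cons
    have h1 : cprod l * cvec v = (-1 : ℝ) ^ l.length • (cvec v * cprod l) :=
      cprod_mul_cvec_of_ortho fun u hu => by rw [dotProduct_comm]; exact ho u hu
    have h2 : (l.length + 1) * (l.length + 1 + 1) / 2 =
        l.length * (l.length + 1) / 2 + l.length + 1 := by
      have : (l.length + 1) * (l.length + 1 + 1) =
        l.length * (l.length + 1) + (l.length + 1) * 2 := by ring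
      rw [this, Nat.add_mul_div_right _ _ two_pos, add_assoc]
    calc cprod (v :: l) * cprod (v :: l)
        = cvec v * (cprod l * cvec v) * cprod l := by simp only [cprod_cons, mul_assoc]
      _ = (-1 : ℝ) ^ l.length • ((cvec v * cvec v) * (cprod l * cprod l)) := by
          rw [h1, mul_smul_comm, smul_mul_assoc]; simp only [mul_assoc]
      _ = _ := by
          rw [cvec_mul_self_of_unit hv, ih hl', List.length_cons, h2, pow_succ, pow_add,
            neg_one_mul, smul_neg, smul_smul, mul_neg_one, neg_smul, mul_comm]

/-! ### The covering: orthogonality and kernel -/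

theorem algebraMap_clifford_injective (m : ℕ) :
    Function.Injective (algebraMap ℝ (CliffordAlgebra (negEuclideanForm m))) := by
  have : Invertible (2 : ℝ) := invertibleOfNonzero two_ne_zero
  have : Nontrivial (CliffordAlgebra (negEuclideanForm m)) :=
    (CliffordAlgebra.equivExterior (negEuclideanForm m)).toEquiv.nontrivial
  exact (algebraMap ℝ _).injective

theorem spinCover_eq_iff {m : ℕ} (x : Spin m) (v w : Fin m → ℝ) :
    spinCover m x v = w ↔
      (x : CliffordAlgebra (negEuclideanForm m)) * cvec v = cvec w * x := by
  have h1 : cvec (spinCover m x v) = (x : CliffordAlgebra (negEuclideanForm m)) * cvec v *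
      ((x⁻¹ : Spin m) : CliffordAlgebra (negEuclideanForm m)) := Spin.ι_act x v
  have h2 : ((x⁻¹ : Spin m) : CliffordAlgebra (negEuclideanForm m)) * x = 1 :=
    spinGroup.coe_star_mul_self x
  have h3 : (x : CliffordAlgebra (negEuclideanForm m)) * ((x⁻¹ : Spin m) :) = 1 :=
    spinGroup.coe_mul_star_self x
  constructor
  · rintro rfl
    rw [h1, mul_assoc, h2, mul_one]
  · intro h
    apply ι_negEuclideanForm_injective m
    change cvec _ = cvec _
    rw [h1, h, mul_assoc, h3, mul_one]

theorem spinCover_spec {m : ℕ} (x : Spin m) (v : Fin m → ℝ) :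
    (x : CliffordAlgebra (negEuclideanForm m)) * cvec v = cvec (spinCover m x v) * x :=
  (spinCover_eq_iff x v _).1 rfl

theorem spinCover_dotProduct {m : ℕ} (x : Spin m) (v w : Fin m → ℝ) :
    spinCover m x v ⬝ᵥ spinCover m x w = v ⬝ᵥ w := by
  have key : ∀ v, spinCover m x v ⬝ᵥ spinCover m x v = v ⬝ᵥ v := by
    intro v
    have h3 : (x : CliffordAlgebra (negEuclideanForm m)) * ((x⁻¹ : Spin m) :) = 1 :=
      spinGroup.coe_mul_star_self x
    have h1 : cvec (spinCover m x v) * cvec (spinCover m x v) * x =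
        (x : CliffordAlgebra (negEuclideanForm m)) * (cvec v * cvec v) := by
      rw [mul_assoc, ← spinCover_spec, ← mul_assoc, ← spinCover_spec, mul_assoc]
    rw [cvec_mul_self, cvec_mul_self, Algebra.commutes, ← sub_eq_zero, ← mul_sub,
      ← map_sub] at h1
    have h2 := congrArg (fun y => ((x⁻¹ : Spin m) : CliffordAlgebra (negEuclideanForm m)) * y) h1
    have h4 : ((x⁻¹ : Spin m) : CliffordAlgebra (negEuclideanForm m)) * x = 1 :=
      spinGroup.coe_star_mul_self x
    simp only [← mul_assoc, h4, one_mul, mul_zero] at h2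
    have h5 := algebraMap_clifford_injective m
      (h2.trans (map_zero _).symm)
    linarith
  have h := key (v + w)
  simp only [map_add, add_dotProduct, dotProduct_add, key,
    dotProduct_comm (spinCover m x w) (spinCover m x v), dotProduct_comm w v] at h
  linarith

/-- Each vector contributes a factor `ε`; an even product contributes a power of `ε * ε = 1`. The
sign `ε` is needed because products of an odd number of vectors occur as `z`. -/
theorem commute_of_mem_even {m : ℕ} {z : CliffordAlgebra (negEuclideanForm m)} {ε : ℝ}
    (hε : ε * ε = 1) (hz : ∀ v, z * cvec v = ε • (cvec v * z))
    {x : CliffordAlgebra (negEuclideanForm m)}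
    (hx : x ∈ CliffordAlgebra.even (negEuclideanForm m)) : z * x = x * z := by
  have hx' : x ∈ CliffordAlgebra.evenOdd (negEuclideanForm m) 0 := hx
  clear hx
  induction x, hx' using CliffordAlgebra.even_induction with
  | algebraMap r => exact (Algebra.commutes r z).symm
  | add x y hx hy ihx ihy => rw [mul_add, add_mul, ihx, ihy]
  | ι_mul_ι_mul v w x hx ih =>
    calc z * (cvec v * cvec w * x) = (z * cvec v) * cvec w * x := by simp only [mul_assoc]
      _ = ε • (cvec v * (z * cvec w) * x) := by rw [hz]; simp only [mul_assoc, smul_mul_assoc]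
      _ = cvec v * cvec w * (z * x) := by
        rw [hz, mul_smul_comm, smul_mul_assoc, smul_smul, hε, one_smul]; simp only [mul_assoc]
      _ = _ := by rw [ih]; simp only [mul_assoc]

/-- The `i`-th standard basis vector, as an element of the Clifford algebra. -/
def cgen {m : ℕ} (i : Fin m) : CliffordAlgebra (negEuclideanForm m) := cvec (Pi.single i 1)

theorem cgen_mul_self {m : ℕ} (i : Fin m) : cgen i * cgen i = -1 :=
  cvec_mul_self_of_unit (by simp)

theorem cgen_mul_comm {m : ℕ} {i j : Fin m} (h : i ≠ j) : cgen i * cgen j = -(cgen j * cgen i) :=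
  cvec_mul_comm_of_ortho (by simp [h.symm])

theorem cvec_eq_sum {m : ℕ} (v : Fin m → ℝ) : cvec v = ∑ i, v i • cgen i := by
  conv_lhs => rw [pi_eq_sum_univ' v]
  simp only [map_sum, map_smul, cgen]

/-- The product of the generators indexed by a list. -/
def cmon {m : ℕ} (s : List (Fin m)) : CliffordAlgebra (negEuclideanForm m) := (s.map cgen).prod

theorem cmon_cons {m : ℕ} (i : Fin m) (s : List (Fin m)) : cmon (i :: s) = cgen i * cmon s :=
  List.prod_cons

theorem cgen_mul_cmon {m : ℕ} {i : Fin m} {s : List (Fin m)} (h : ∀ j ∈ s, j ≠ i) :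
    cgen i * cmon s = (-1 : ℝ) ^ s.length • (cmon s * cgen i) := by
  induction s with
  | nil => simp [cmon]
  | cons j s ih =>
    rw [cmon_cons, ← mul_assoc, cgen_mul_comm (h j List.mem_cons_self).symm, neg_mul, mul_assoc,
      ih fun k hk => h k (List.mem_cons_of_mem j hk), List.length_cons, pow_succ, mul_neg_one,
      neg_smul, mul_smul_comm, mul_assoc]

theorem exists_cmon_eq {m : ℕ} (i : Fin m) (s : List (Fin m)) :
    ∃ (δ : ℝ) (s' : List (Fin m)) (c : ℕ), (∀ j ∈ s', j ∈ s ∧ j ≠ i) ∧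
      s'.length + c = s.length ∧ cmon s = δ • (cmon s' * cgen i ^ c) := by
  induction s with
  | nil => exact ⟨1, [], 0, by simp, rfl, by simp⟩
  | cons j s ih =>
    obtain ⟨δ, s', c, h1, h2, h3⟩ := ih
    by_cases hj : j = i
    · refine ⟨δ * (-1) ^ s'.length, s', c + 1,
        fun k hk => ⟨List.mem_cons_of_mem _ (h1 k hk).1, (h1 k hk).2⟩, ?_, ?_⟩
      · rw [List.length_cons]; omega
      · rw [cmon_cons, h3, hj, mul_smul_comm, ← mul_assoc, cgen_mul_cmon fun k hk => (h1 k hk).2,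
          smul_mul_assoc, smul_smul, mul_assoc, pow_succ']
    · refine ⟨δ, j :: s', c, ?_, ?_, ?_⟩
      · rintro k (_ | ⟨_, hk⟩)
        · exact ⟨List.mem_cons_self, hj⟩
        · exact ⟨List.mem_cons_of_mem _ (h1 k hk).1, (h1 k hk).2⟩
      · rw [List.length_cons, List.length_cons]; omega
      · rw [cmon_cons, h3, mul_smul_comm, cmon_cons, mul_assoc]

/-- The span of the even monomials in the generators with index in `S`. -/
def cmonSpan {m : ℕ} (S : Finset (Fin m)) :
    Submodule ℝ (CliffordAlgebra (negEuclideanForm m)) :=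
  Submodule.span ℝ {y | ∃ s : List (Fin m), (∀ j ∈ s, j ∈ S) ∧ Even s.length ∧ cmon s = y}

theorem cmon_mem_cmonSpan {m : ℕ} {S : Finset (Fin m)} {s : List (Fin m)} (h : ∀ j ∈ s, j ∈ S)
    (h' : Even s.length) : cmon s ∈ cmonSpan S :=
  Submodule.subset_span ⟨s, h, h', rfl⟩

/-- On an even monomial, `y ↦ y - eᵢ y eᵢ` is multiplication by `2` if `eᵢ` occurs an even number of
times, and then `eᵢ` can be removed up to sign; otherwise it gives `0`. It is thus twice a
projection that eliminates `eᵢ`. -/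
theorem sub_cgen_conj_mem {m : ℕ} {S : Finset (Fin m)} (i : Fin m)
    {y : CliffordAlgebra (negEuclideanForm m)} (hy : y ∈ cmonSpan S) :
    y - cgen i * y * cgen i ∈ cmonSpan (S.erase i) := by
  induction hy using Submodule.span_induction with
  | mem y hy =>
    obtain ⟨s, hs, he, rfl⟩ := hy
    obtain ⟨δ, s', c, h1, h2, h3⟩ := exists_cmon_eq i s
    have h4 : cgen i * cmon s * cgen i = -((-1 : ℝ) ^ s'.length • cmon s) := by
      rw [h3, mul_smul_comm, ← mul_assoc, cgen_mul_cmon fun k hk => (h1 k hk).2, smul_mul_assoc,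
        smul_mul_assoc, smul_mul_assoc, mul_assoc (cmon s'), ← pow_succ', mul_assoc, pow_succ,
        mul_assoc, cgen_mul_self, smul_comm]
      simp
    rw [h4]
    rcases Nat.even_or_odd s'.length with h5 | h5
    · rw [h5.neg_one_pow, one_smul, sub_neg_eq_add, h3]
      obtain ⟨d, rfl⟩ : Even c := by
        rw [← h2, Nat.even_add] at he; exact he.1 h5
      rw [← two_mul d, pow_mul, pow_two, cgen_mul_self]
      have h6 : cmon s' ∈ cmonSpan (S.erase i) :=
        cmon_mem_cmonSpan (fun j hj => Finset.mem_erase.2 ⟨(h1 j hj).2, hs j (h1 j hj).1⟩) h5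
      rcases neg_one_pow_eq_or (CliffordAlgebra (negEuclideanForm m)) d with h | h <;> rw [h]
      · rw [mul_one]; exact add_mem (Submodule.smul_mem _ _ h6) (Submodule.smul_mem _ _ h6)
      · rw [mul_neg_one]
        exact add_mem (Submodule.smul_mem _ _ (neg_mem h6)) (Submodule.smul_mem _ _ (neg_mem h6))
    · rw [h5.neg_one_pow, neg_one_smul, neg_neg, sub_self]; exact zero_mem _
  | zero => simp
  | add y z _ _ hy hz =>
    have : y + z - cgen i * (y + z) * cgen i =
      (y - cgen i * y * cgen i) + (z - cgen i * z * cgen i) := by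
        rw [mul_add, add_mul]; abel
    rw [this]; exact add_mem hy hz
  | smul r y _ hy =>
    rw [mul_smul_comm, smul_mul_assoc, ← smul_sub]
    exact Submodule.smul_mem _ _ hy

theorem mem_cmonSpan_univ {m : ℕ} {x : CliffordAlgebra (negEuclideanForm m)}
    (hx : x ∈ CliffordAlgebra.even (negEuclideanForm m)) : x ∈ cmonSpan Finset.univ := by
  have hx' : x ∈ CliffordAlgebra.evenOdd (negEuclideanForm m) 0 := hx
  clear hx
  induction x, hx' using CliffordAlgebra.even_induction with
  | algebraMap r =>
    rw [Algebra.algebraMap_eq_smul_one]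
    exact Submodule.smul_mem _ _ (cmon_mem_cmonSpan (s := []) (by simp) (by simp))
  | add x y hx hy ihx ihy => exact add_mem ihx ihy
  | ι_mul_ι_mul v w x hx ih =>
    have h : ∀ (y) (i j : Fin m), y ∈ cmonSpan (m := m) Finset.univ →
        cgen i * cgen j * y ∈ cmonSpan Finset.univ := by
      intro y i j hy
      induction hy using Submodule.span_induction with
      | mem y hy =>
        obtain ⟨s, _, he, rfl⟩ := hy
        rw [mul_assoc, ← cmon_cons, ← cmon_cons]
        exact cmon_mem_cmonSpan (by simp) (by simpa [Nat.even_add_one] using he)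
      | zero => simp
      | add y z _ _ hy hz => rw [mul_add]; exact add_mem hy hz
      | smul r y _ hy => rw [mul_smul_comm]; exact Submodule.smul_mem _ _ hy
    change cvec v * cvec w * x ∈ _
    rw [cvec_eq_sum v, cvec_eq_sum w, Finset.sum_mul_sum, Finset.sum_mul]
    refine Submodule.sum_mem _ fun i _ => ?_
    rw [Finset.sum_mul]
    refine Submodule.sum_mem _ fun j _ => ?_
    rw [smul_mul_smul_comm, smul_mul_assoc]
    exact Submodule.smul_mem _ _ (h x i j ih)

/-- An even element commuting with all vectors is a scalar. -/
theorem exists_eq_algebraMap_of_even {m : ℕ} {x : CliffordAlgebra (negEuclideanForm m)}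
    (hx : x ∈ CliffordAlgebra.even (negEuclideanForm m)) (hc : ∀ v, x * cvec v = cvec v * x) :
    ∃ c : ℝ, x = algebraMap ℝ _ c := by
  have key : ∀ T : Finset (Fin m), x ∈ cmonSpan (Finset.univ \ T) := by
    intro T
    induction T using Finset.induction_on with
    | empty => rw [Finset.sdiff_empty]; exact mem_cmonSpan_univ hx
    | insert i T hi ih =>
      -- Since `x` commutes with `eᵢ` and `eᵢ² = -1`, the element `x - eᵢ x eᵢ` is `2 x`. So every
      -- generator can be eliminated from `x`, one after the other.
      have h := sub_cgen_conj_mem i ih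
      have h2 : cgen i * x * cgen i = -x := by
        rw [cgen, ← hc, mul_assoc, cvec_mul_self_of_unit (by simp), mul_neg_one]
      rw [h2, sub_neg_eq_add, ← two_smul ℝ] at h
      rw [Finset.sdiff_insert]
      simpa using Submodule.smul_mem _ (2⁻¹ : ℝ) h
  have h := key Finset.univ
  rw [Finset.sdiff_self] at h
  have h3 : cmonSpan (∅ : Finset (Fin m)) ≤ Submodule.span ℝ {1} := by
    refine Submodule.span_mono ?_
    rintro _ ⟨s, hs, _, rfl⟩
    obtain rfl : s = [] := List.eq_nil_iff_forall_not_mem.2 fun j hj => by simpa using hs j hj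
    rfl
  obtain ⟨c, hc⟩ := Submodule.mem_span_singleton.1 (h3 h)
  exact ⟨c, by rw [Algebra.algebraMap_eq_smul_one, hc]⟩

/-- The kernel of the standard covering is contained in `{1, -1}`. -/
theorem eq_one_or_neg_one_of_spinCover_eq_one {m : ℕ} {x : Spin m} (h : spinCover m x = 1) :
    (x : CliffordAlgebra (negEuclideanForm m)) = 1 ∨
      (x : CliffordAlgebra (negEuclideanForm m)) = -1 := by
  obtain ⟨c, hc⟩ := exists_eq_algebraMap_of_even (spinGroup.mem_even x.2) fun v => by
    have := spinCover_spec x v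
    rwa [h] at this
  have h1 := spinGroup.coe_star_mul_self x
  rw [hc, CliffordAlgebra.star_algebraMap, ← map_mul] at h1
  have h2 := algebraMap_clifford_injective m
    (h1.trans (map_one _).symm)
  rcases mul_self_eq_one_iff.1 h2 with rfl | rfl
  · left; rw [hc, map_one]
  · right; rw [hc, map_neg, map_one]

/-! ### The element `-1`, lifts of involutions, and conjugacy of `x` and `-x` -/

theorem Spin.one_ne_neg_one {m : ℕ} : (1 : CliffordAlgebra (negEuclideanForm m)) ≠ -1 := by
  intro h
  have := algebraMap_clifford_injective m
    (show algebraMap ℝ _ 1 = algebraMap ℝ _ (-1) by rw [map_neg, map_one]; exact h)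
  norm_num at this

theorem Spin.exists_neg_one {m : ℕ} (hm : 0 < m) :
    ∃ z : Spin m, (z : CliffordAlgebra (negEuclideanForm m)) = -1 := by
  have h : (Pi.single ⟨0, hm⟩ 1 : Fin m → ℝ) ⬝ᵥ Pi.single ⟨0, hm⟩ 1 = 1 := by simp
  refine ⟨⟨cprod [Pi.single ⟨0, hm⟩ 1, Pi.single ⟨0, hm⟩ 1],
    cprod_mem_spinGroup (by simp) (by simp)⟩, ?_⟩
  simp [cvec_mul_self_of_unit h]

/-- The map `(1 - A) / 2` is a projection onto the `-1`-eigenspace, so its trace is the dimension of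
that eigenspace. -/
theorem trace_of_involution {V : Type*} [AddCommGroup V] [Module ℝ V] [FiniteDimensional ℝ V]
    {A : V →ₗ[ℝ] V} (hA : ∀ v, A (A v) = v) :
    LinearMap.trace ℝ V A =
      Module.finrank ℝ V - 2 * Module.finrank ℝ (LinearMap.ker (A + 1)) := by
  have hP : LinearMap.IsProj (LinearMap.ker (A + 1)) ((2⁻¹ : ℝ) • (1 - A)) := by
    refine ⟨fun v => ?_, fun v hv => ?_⟩
    · simp [LinearMap.mem_ker, hA]
    · have h : A v = -v := by
        rw [LinearMap.mem_ker, LinearMap.add_apply, Module.End.one_apply] at hv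
        exact eq_neg_of_add_eq_zero_left hv
      simp [h, ← two_smul ℝ v, smul_smul]
  have h := LinearMap.IsProj.trace hP
  rw [map_smul, map_sub, LinearMap.trace_one, smul_eq_mul] at h
  linarith

/-- Every subspace of `ℝᵐ` is spanned by an orthonormal list. -/
theorem exists_isOrthonormalList_span {m : ℕ} (E : Submodule ℝ (Fin m → ℝ)) :
    ∃ l : List (Fin m → ℝ), IsOrthonormalList l ∧ l.length = Module.finrank ℝ E ∧
      Submodule.span ℝ {v | v ∈ l} = E := by
  let e : (Fin m → ℝ) ≃ₗ[ℝ] EuclideanSpace ℝ (Fin m) := (WithLp.linearEquiv 2 ℝ (Fin m → ℝ)).symm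
  let E' := E.map e.toLinearMap
  have hfin : Module.finrank ℝ E' = Module.finrank ℝ E := LinearEquiv.finrank_map_eq e E
  let b := stdOrthonormalBasis ℝ E'
  let f : Fin (Module.finrank ℝ E') → (Fin m → ℝ) := fun i => e.symm (b i)
  have hdot : ∀ i j, f i ⬝ᵥ f j = if i = j then 1 else 0 := by
    intro i j
    rw [← orthonormal_iff_ite.1 b.orthonormal i j]
    simp only [Submodule.coe_inner, PiLp.inner_apply, dotProduct, f]
    refine Finset.sum_congr rfl fun k _ => ?_
    rw [mul_comm]; rfl
  refine ⟨List.ofFn f, ⟨?_, ?_⟩, by rw [List.length_ofFn, hfin], ?_⟩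
  · intro v hv
    obtain ⟨i, rfl⟩ := List.mem_ofFn.1 hv
    rw [hdot, if_pos rfl]
  · rw [List.pairwise_ofFn]
    intro i j hij
    rw [hdot, if_neg hij.ne]
  · have h1 : {v | v ∈ List.ofFn f} = e.symm.toLinearMap '' (E'.subtype '' Set.range b) := by
      ext v
      simp [List.mem_ofFn, f]
    have h2 : Submodule.span ℝ (Set.range b) = ⊤ := by
      rw [← b.coe_toBasis]; exact b.toBasis.span_eq
    rw [h1, Submodule.span_image, Submodule.span_image, h2, Submodule.map_top,
      Submodule.range_subtype]
    change (E.map e.toLinearMap).map e.symm.toLinearMap = E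
    rw [← Submodule.map_comp]
    simp

/-- An orthogonal involution of `ℝᵐ` whose `-1`-eigenspace has dimension divisible by `4` lifts to
an involution in `Spin m`. -/
theorem exists_spin_lift_of_involution {m : ℕ} {A : (Fin m → ℝ) →ₗ[ℝ] (Fin m → ℝ)}
    (hA : ∀ v, A (A v) = v) (hdot : ∀ v w, A v ⬝ᵥ A w = v ⬝ᵥ w)
    (h4 : 4 ∣ Module.finrank ℝ (LinearMap.ker (A + 1))) :
    ∃ x : Spin m, x * x = 1 ∧ spinCover m x = A := by
  obtain ⟨l, hl, hlen, hspan⟩ := exists_isOrthonormalList_span (LinearMap.ker (A + 1))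
  rw [← hlen] at h4
  have he : Even l.length := (show Even 4 by decide).trans_dvd h4
  -- The lift is the Clifford product of an orthonormal basis of the `-1`-eigenspace. Its length is
  -- even, so it anticommutes with the vectors of that space and commutes with those orthogonal to
  -- it.
  refine ⟨⟨cprod l, cprod_mem_spinGroup hl.1 he⟩, Subtype.ext ?_, LinearMap.ext fun y => ?_⟩
  · change cprod l * cprod l = 1
    obtain ⟨c, hc⟩ := h4
    have : Even (l.length * (l.length + 1) / 2) := by
      rw [hc, show 4 * c * (4 * c + 1) = 2 * (2 * (c * (4 * c + 1))) by ring,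
        Nat.mul_div_cancel_left _ two_pos]
      exact even_two_mul _
    rw [cprod_mul_self hl, this.neg_one_pow, one_smul]
  · rw [spinCover_eq_iff]
    change cprod l * cvec y = cvec (A y) * cprod l
    have hneg : ∀ w ∈ LinearMap.ker (A + 1), cprod l * cvec w = -(cvec w * cprod l) := by
      intro w hw
      rw [← hspan] at hw
      induction hw using Submodule.span_induction with
      | mem w hw => rw [cprod_mul_cvec_of_mem hl hw, he.neg_one_pow, one_smul]
      | zero => simp
      | add v w _ _ hv hw => rw [map_add, mul_add, add_mul, hv, hw, neg_add]
      | smul r v _ hv => rw [map_smul, mul_smul_comm, hv, smul_mul_assoc, smul_neg]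
    have hpos : cprod l * cvec (y + A y) = cvec (y + A y) * cprod l := by
      rw [cprod_mul_cvec_of_ortho, he.neg_one_pow, one_smul]
      intro v hv
      have hv' : A v = -v := by
        have : v ∈ LinearMap.ker (A + 1) := hspan ▸ Submodule.subset_span hv
        exact eq_neg_of_add_eq_zero_left this
      have := hdot v (A y)
      rw [hA, hv', neg_dotProduct] at this
      rw [dotProduct_add, ← this, add_neg_cancel]
    have hneg' := hneg (y - A y) (by simp [LinearMap.mem_ker, hA])
    have e1 : y = (2⁻¹ : ℝ) • ((y + A y) + (y - A y)) := by
      rw [add_add_sub_cancel, ← two_smul ℝ y, smul_smul]; simp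
    have e2 : A y = (2⁻¹ : ℝ) • ((y + A y) - (y - A y)) := by
      rw [add_sub_sub_cancel, ← two_smul ℝ (A y), smul_smul]; simp
    conv_lhs => rw [e1]
    conv_rhs => rw [e2]
    rw [map_smul, map_add cvec (y + A y) (y - A y), mul_smul_comm, mul_add, hpos, hneg', map_smul,
      map_sub cvec (y + A y) (y - A y), smul_mul_assoc, sub_mul]
    exact congrArg _ (sub_eq_add_neg _ _).symm

theorem Spin.eq_or_coe_eq_neg_of_spinCover_eq {m : ℕ} {x y : Spin m}
    (h : spinCover m x = spinCover m y) :
    x = y ∨ (x : CliffordAlgebra (negEuclideanForm m)) = -y := by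
  have h1 : spinCover m (x * y⁻¹) = 1 := by
    rw [map_mul, h, ← map_mul, mul_inv_cancel, map_one]
  have h2 : (x : CliffordAlgebra (negEuclideanForm m)) = ((x * y⁻¹ : Spin m) :) * y := by
    rw [← Submonoid.coe_mul, inv_mul_cancel_right]
  rcases eq_one_or_neg_one_of_spinCover_eq_one h1 with h3 | h3
  · left; exact Subtype.ext (by rw [h2, h3, one_mul])
  · right; rw [h2, h3, neg_one_mul]

/-- Some lift of the involution squares to `1`, and any other lift differs from it by a sign, which
disappears in the square. -/
theorem Spin.mul_self_eq_one {m : ℕ} {x : Spin m} (hA : ∀ v, spinCover m x (spinCover m x v) = v)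
    (h4 : 4 ∣ Module.finrank ℝ (LinearMap.ker (spinCover m x + 1))) : x * x = 1 := by
  obtain ⟨y, hy, hxy⟩ := exists_spin_lift_of_involution hA (spinCover_dotProduct x) h4
  rcases Spin.eq_or_coe_eq_neg_of_spinCover_eq hxy.symm with rfl | h
  · exact hy
  · refine Subtype.ext ?_
    rw [Submonoid.coe_mul, h, neg_mul_neg, ← Submonoid.coe_mul, hy]

/-- If `spinCover m x` has both eigenvalues `1` and `-1`, then `x` and `-x` are conjugate. -/
theorem Spin.isConj_of_coe_eq_neg {m : ℕ} {x y : Spin m}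
    (hxy : (y : CliffordAlgebra (negEuclideanForm m)) = -x) {u v : Fin m → ℝ} (hu : u ≠ 0)
    (hv : v ≠ 0) (hxu : spinCover m x u = -u) (hxv : spinCover m x v = v) : IsConj x y := by
  have norm : ∀ w : Fin m → ℝ, w ≠ 0 → ∃ c : ℝ, (c • w) ⬝ᵥ (c • w) = 1 := by
    intro w hw
    have h0 : 0 < w ⬝ᵥ w := lt_of_le_of_ne
      (Finset.sum_nonneg fun i _ => mul_self_nonneg _) fun h => hw (dotProduct_self_eq_zero.1 h.symm)
    refine ⟨(Real.sqrt (w ⬝ᵥ w))⁻¹, ?_⟩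
    rw [smul_dotProduct, dotProduct_smul, smul_eq_mul, smul_eq_mul, ← mul_assoc, ← mul_inv,
      Real.mul_self_sqrt h0.le, inv_mul_cancel₀ h0.ne']
  obtain ⟨a, ha⟩ := norm u hu
  obtain ⟨b, hb⟩ := norm v hv
  have hxa : spinCover m x (a • u) = -(a • u) := by rw [map_smul, hxu, smul_neg]
  have hxb : spinCover m x (b • v) = b • v := by rw [map_smul, hxv]
  -- Moving `x` past the `-1`-eigenvector changes the sign and moving it past the fixed vector does
  -- not, so `x w = -w x = w y`.
  let w : Spin m := ⟨cprod [a • u, b • v], cprod_mem_spinGroup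
    (by simp only [List.mem_cons, List.not_mem_nil, or_false]; rintro _ (rfl | rfl) <;> assumption)
    (by simp)⟩
  have hw : (w : CliffordAlgebra (negEuclideanForm m)) = cvec (a • u) * cvec (b • v) := by
    simp [w]
  have h1 : x * w = w * y := by
    refine Subtype.ext ?_
    rw [Submonoid.coe_mul, Submonoid.coe_mul, hxy, hw, ← mul_assoc, spinCover_spec, hxa, mul_assoc,
      spinCover_spec, hxb, map_neg, neg_mul, mul_neg, mul_assoc]
  refine isConj_iff.2 ⟨w⁻¹, ?_⟩
  rw [inv_inv, mul_assoc, h1, inv_mul_cancel_left]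

theorem Spin.neg_one_mul_comm {m : ℕ} {z : Spin m}
    (hz : (z : CliffordAlgebra (negEuclideanForm m)) = -1) (x : Spin m) : z * x = x * z :=
  Subtype.ext (by rw [Submonoid.coe_mul, Submonoid.coe_mul, hz, neg_one_mul, mul_neg_one])

theorem Spin.neg_one_mul_self {m : ℕ} {z : Spin m}
    (hz : (z : CliffordAlgebra (negEuclideanForm m)) = -1) : z * z = 1 :=
  Subtype.ext (by rw [Submonoid.coe_mul, hz, neg_mul_neg, mul_one]; rfl)

theorem Spin.spinCover_neg_one {m : ℕ} {z : Spin m}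
    (hz : (z : CliffordAlgebra (negEuclideanForm m)) = -1) : spinCover m z = 1 := by
  refine LinearMap.ext fun v => ?_
  rw [spinCover_eq_iff, hz, neg_one_mul, mul_neg_one]; rfl

theorem Spin.eq_or_eq_neg_one_mul {m : ℕ} {z : Spin m}
    (hz : (z : CliffordAlgebra (negEuclideanForm m)) = -1) {x y : Spin m}
    (h : spinCover m x = spinCover m y) : x = y ∨ x = z * y := by
  rcases Spin.eq_or_coe_eq_neg_of_spinCover_eq h with h | h
  · exact Or.inl h
  · right; exact Subtype.ext (by rw [Submonoid.coe_mul, hz, h, neg_one_mul])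

/-! ### Lifting representations of symmetric groups -/

/-- An orthogonal representation of `Sym(n + 1)` in which the adjacent transpositions and the
products of two disjoint ones have `-1`-eigenspaces of dimension divisible by `4` lifts to the
spin group. -/
theorem exists_spin_lift_of_representation {m n : ℕ} (hm : 0 < m)
    (ρ : Representation ℝ (Equiv.Perm (Fin (n + 1))) (Fin m → ℝ))
    (hdot : ∀ σ v w, ρ σ v ⬝ᵥ ρ σ w = v ⬝ᵥ w)
    (h1 : ∀ i < n, 4 ∣ Module.finrank ℝ (LinearMap.ker (ρ (adjacentSwap n i) + 1)))
    (h2 : ∀ i j, i + 2 ≤ j → j < n →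
      4 ∣ Module.finrank ℝ (LinearMap.ker (ρ (adjacentSwap n i * adjacentSwap n j) + 1))) :
    ∃ φ : Equiv.Perm (Fin (n + 1)) →* Spin m, ∀ σ, spinCover m (φ σ) = ρ σ := by
  obtain ⟨z, hz⟩ := Spin.exists_neg_one hm
  have hs := isCoxeterFamily_adjacentSwap n
  have hinv : ∀ σ : Equiv.Perm (Fin (n + 1)), σ * σ = 1 → ∀ v, ρ σ (ρ σ v) = v :=
    fun σ h v => by rw [← Module.End.mul_apply, ← map_mul, h, map_one]; rfl
  have hex : ∀ i, ∃ y : Spin m, i < n → spinCover m y = ρ (adjacentSwap n i) := fun i => by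
    by_cases hi : i < n
    · obtain ⟨y, -, hy⟩ := exists_spin_lift_of_involution (hinv _ (hs.sq i hi))
        (hdot (adjacentSwap n i)) (h1 i hi)
      exact ⟨y, fun _ => hy⟩
    · exact ⟨1, fun h => absurd h hi⟩
  choose y hy using hex
  -- Both sides of the braid relation have the same projection, so they differ at most by `z = -1`.
  -- Replacing `t'` by `z t'` changes the side with one `t'` by `z` and the side with two by `z² =
  -- 1`, so one of the two lifts satisfies the relation.
  have hstep : ∀ (t : Spin m) (i : ℕ), ∃ t' : Spin m, i + 1 < n →
      spinCover m t = ρ (adjacentSwap n i) →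
      spinCover m t' = ρ (adjacentSwap n (i + 1)) ∧ t * t' * t = t' * t * t' := by
    intro t i
    by_cases hi : i + 1 < n
    swap; · exact ⟨1, fun h => absurd h hi⟩
    by_cases ht : spinCover m t = ρ (adjacentSwap n i)
    swap; · exact ⟨1, fun _ h => absurd h ht⟩
    have h : spinCover m (t * y (i + 1) * t) = spinCover m (y (i + 1) * t * y (i + 1)) := by
      simp only [map_mul, ht, hy (i + 1) hi]
      rw [← map_mul, ← map_mul, hs.braid i hi, map_mul, map_mul]
    rcases Spin.eq_or_eq_neg_one_mul hz h with h | h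
    · exact ⟨y (i + 1), fun _ _ => ⟨hy _ hi, h⟩⟩
    · refine ⟨z * y (i + 1), fun _ _ => ⟨?_, ?_⟩⟩
      · rw [map_mul, Spin.spinCover_neg_one hz, one_mul, hy _ hi]
      · have hc := Spin.neg_one_mul_comm hz
        calc t * (z * y (i + 1)) * t = z * (t * y (i + 1) * t) := by
              rw [← mul_assoc, ← hc t, mul_assoc z t, mul_assoc z]
          _ = z * y (i + 1) * t * (z * y (i + 1)) := by
              rw [h, ← mul_assoc (z * y (i + 1) * t), ← hc]
              simp only [mul_assoc]
  choose f hf using hstep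
  let T : ℕ → Spin m := fun i => Nat.rec (y 0) (fun i t => f t i) i
  have hT : ∀ i < n, spinCover m (T i) = ρ (adjacentSwap n i) := by
    intro i
    induction i with
    | zero => exact hy 0
    | succ i ih => exact fun hi => (hf (T i) i hi (ih (by omega))).1
  have hsq : ∀ i < n, T i * T i = 1 := fun i hi =>
    Spin.mul_self_eq_one (by rw [hT i hi]; exact hinv _ (hs.sq i hi)) (by rw [hT i hi]; exact h1 i hi)
  have hcox : IsCoxeterFamily n T := by
    refine ⟨hsq, fun i hi => (hf (T i) i hi (hT i (by omega))).2, fun i j hij hj => ?_⟩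
    have hi : i < n := by omega
    have h : spinCover m (T i * T j) = ρ (adjacentSwap n i * adjacentSwap n j) := by
      rw [map_mul, map_mul, hT i hi, hT j hj]
    have hsq2 : adjacentSwap n i * adjacentSwap n j * (adjacentSwap n i * adjacentSwap n j) = 1 := by
      rw [mul_assoc, ← mul_assoc (adjacentSwap n j), ← hs.comm i j hij hj,
        mul_assoc (adjacentSwap n i) (adjacentSwap n j), hs.sq j hj, mul_one, hs.sq i hi]
    have h3 : T i * T j * (T i * T j) = 1 :=
      Spin.mul_self_eq_one (by rw [h]; exact hinv _ hsq2) (by rw [h]; exact h2 i j hij hj)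
    -- Two involutions whose product is an involution commute.
    calc T i * T j = (T i * T j)⁻¹ := eq_inv_of_mul_eq_one_left h3
      _ = T j * T i := by
        rw [mul_inv_rev, inv_eq_of_mul_eq_one_left (hsq i hi), inv_eq_of_mul_eq_one_left (hsq j hj)]
  obtain ⟨φ, hφ⟩ := hcox.exists_hom
  have heq : (spinCover m).comp φ = ρ := by
    refine MonoidHom.eq_of_eqOn_dense (closure_adjacentSwap n) ?_
    rintro _ ⟨i, hi, rfl⟩
    change spinCover m (φ (adjacentSwap n i)) = _
    rw [hφ i hi, hT i hi]
  exact ⟨φ, fun σ => DFunLike.congr_fun heq σ⟩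

/-! ### Tensor products and lifts of `1 ⊗ B` -/

/-- The Clifford algebra containing `Spin m`. -/
abbrev EuclideanClifford (m : ℕ) : Type := CliffordAlgebra (negEuclideanForm m)

/-- The pure tensor `v ⊗ u` in `ℝᵈ ⊗ ℝᵏ = ℝᵈᵏ`. -/
def tens {d k : ℕ} : (Fin d → ℝ) →ₗ[ℝ] (Fin k → ℝ) →ₗ[ℝ] (Fin (d * k) → ℝ) :=
  LinearMap.mk₂ ℝ (fun v u p => v (finProdFinEquiv.symm p).1 * u (finProdFinEquiv.symm p).2)
    (fun _ _ _ => by ext; simp [add_mul]) (fun _ _ _ => by ext; simp [mul_assoc])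
    (fun _ _ _ => by ext; simp [mul_add]) (fun _ _ _ => by ext; simp [mul_left_comm])

theorem tens_apply {d k : ℕ} (v : Fin d → ℝ) (u : Fin k → ℝ) (i : Fin d) (j : Fin k) :
    tens v u (finProdFinEquiv (i, j)) = v i * u j := by
  change v (finProdFinEquiv.symm _).1 * u (finProdFinEquiv.symm _).2 = _
  rw [Equiv.symm_apply_apply]

theorem tens_dotProduct_tens {d k : ℕ} (v v' : Fin d → ℝ) (u u' : Fin k → ℝ) :
    tens v u ⬝ᵥ tens v' u' = (v ⬝ᵥ v') * (u ⬝ᵥ u') := by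
  simp only [dotProduct]
  rw [← finProdFinEquiv.sum_comp, Fintype.sum_prod_type, Finset.sum_mul_sum]
  refine Finset.sum_congr rfl fun i _ => Finset.sum_congr rfl fun j _ => ?_
  rw [tens_apply, tens_apply]; ring

theorem eq_sum_tens {d k : ℕ} (y : Fin (d * k) → ℝ) :
    y = ∑ i, tens (Pi.single i 1) (fun j => y (finProdFinEquiv (i, j))) := by
  ext p
  obtain ⟨⟨i, j⟩, rfl⟩ := finProdFinEquiv.surjective p
  simp [Finset.sum_apply, tens_apply, Pi.single_apply]

theorem spin_mul_cprod {m : ℕ} (x : Spin m) {ι : Type*} (f : ι → Fin m → ℝ) (s : ι → ℝ)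
    (hx : ∀ i, spinCover m x (f i) = s i • f i) (l : List ι) :
    (x : CliffordAlgebra (negEuclideanForm m)) * cprod (l.map f) =
      (l.map s).prod • (cprod (l.map f) * x) := by
  induction l with
  | nil => simp
  | cons i l ih =>
    rw [List.map_cons, cprod_cons, ← mul_assoc, spinCover_spec, hx, map_smul, mul_assoc, ih,
      List.map_cons, List.prod_cons, smul_mul_assoc, mul_smul_comm, smul_smul, mul_assoc]

section
variable {d k : ℕ}

/-- The orthonormal list `e₁ ⊗ w, …, e_d ⊗ w`, for a unit vector `w`. -/
theorem isOrthonormalList_tens {w : Fin k → ℝ} (hw : w ⬝ᵥ w = 1) :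
    IsOrthonormalList ((List.finRange d).map fun i => tens (Pi.single i (1 : ℝ)) w) := by
  refine ⟨?_, ?_⟩
  · intro v hv
    obtain ⟨i, -, rfl⟩ := List.mem_map.1 hv
    rw [tens_dotProduct_tens, hw]; simp
  · rw [List.pairwise_map]
    refine (List.nodup_finRange d).imp fun {i j} hij => ?_
    rw [tens_dotProduct_tens]; simp [hij.symm]

/-- Up to the sign `(-1) ^ d`, conjugation by this product is `1 ⊗ R`, with `R` the reflection in
the hyperplane orthogonal to `w`. To see this, split `u` into a multiple of `w`, which gives a
vector of the list, and a part orthogonal to `w`, which gives a vector orthogonal to the whole list.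
-/
theorem cprod_tens_mul_cvec {w : Fin k → ℝ} (hw : w ⬝ᵥ w = 1) (i : Fin d) (u : Fin k → ℝ) :
    cprod ((List.finRange d).map fun i => tens (Pi.single i (1 : ℝ)) w) *
        cvec (tens (Pi.single i 1) u) =
      (-1 : ℝ) ^ d • (cvec (tens (Pi.single i 1) (u - (2 * (w ⬝ᵥ u)) • w)) *
        cprod ((List.finRange d).map fun i => tens (Pi.single i (1 : ℝ)) w)) := by
  set l := (List.finRange d).map fun i => tens (Pi.single i (1 : ℝ)) w
  have hlen : l.length = d := by simp [l]
  set c := w ⬝ᵥ u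
  have h1 := cprod_mul_cvec_of_ortho (l := l) (w := tens (Pi.single i 1) (u - c • w)) (by
    intro v hv
    obtain ⟨j, -, rfl⟩ := List.mem_map.1 hv
    rw [tens_dotProduct_tens, dotProduct_sub, dotProduct_smul, hw, smul_eq_mul, mul_one, sub_self,
      mul_zero])
  have h2 := cprod_mul_cvec_of_mem (isOrthonormalList_tens (d := d) hw)
    (List.mem_map.2 ⟨i, List.mem_finRange i, rfl⟩)
  change cprod l * _ = -((-1 : ℝ) ^ l.length • (_ * cprod l)) at h2
  rw [hlen] at h1 h2
  have e1 : tens (Pi.single i (1 : ℝ)) u =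
      tens (Pi.single i 1) (u - c • w) + c • tens (Pi.single i 1) w := by
    rw [← map_smul, ← map_add, sub_add_cancel]
  have e2 : tens (Pi.single i (1 : ℝ)) (u - (2 * c) • w) =
      tens (Pi.single i 1) (u - c • w) - c • tens (Pi.single i 1) w := by
    rw [← map_smul, ← map_sub, two_mul, add_smul, sub_sub]
  clear_value l
  generalize tens (Pi.single i (1 : ℝ)) (u - c • w) = p at *
  generalize tens (Pi.single i (1 : ℝ)) w = q at *
  rw [e1, e2, map_add, map_sub, mul_add, h1, map_smul, mul_smul_comm, h2, sub_mul, smul_sub,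
    smul_neg, smul_mul_assoc, smul_comm c, sub_eq_add_neg]

/-- If `x` acts on `ℝᵈ ⊗ ℝᵏ` diagonally on the first factor with determinant `1` and `g` acts as
`1 ⊗ B`, then `x` and `g` commute. -/
theorem Spin.commute_of_tens {x g : Spin (d * k)} {s : Fin d → ℝ} (hs : ∏ i, s i = 1)
    (hx : ∀ i u, spinCover _ x (tens (Pi.single i 1) u) = s i • tens (Pi.single i 1) u)
    (B : EuclideanSpace ℝ (Fin k) ≃ₗᵢ[ℝ] EuclideanSpace ℝ (Fin k))
    (hg : ∀ i u, spinCover _ g (tens (Pi.single i 1) u) =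
      tens (Pi.single i 1) (B (WithLp.toLp 2 u)).ofLp) : g * x = x * g := by
  -- Every isometry is a product of reflections, so it suffices to implement `1 ⊗ R` for a
  -- reflection `R`, up to a sign, by a Clifford unit that commutes with `x`. The unit need not be
  -- even, since a single reflection may reverse orientation.
  have key : ∀ B : EuclideanSpace ℝ (Fin k) ≃ₗᵢ[ℝ] EuclideanSpace ℝ (Fin k),
      ∃ W : (EuclideanClifford (d * k))ˣ, (W : EuclideanClifford (d * k)) * x = x * W ∧
        ∃ ε : ℝ, ε * ε = 1 ∧ ∀ (i : Fin d) (u : Fin k → ℝ), (W : EuclideanClifford (d * k)) * cvec (tens (Pi.single i (1 : ℝ)) u) =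
          ε • (cvec (tens (Pi.single i 1) (B (WithLp.toLp 2 u)).ofLp) * W) := by
    intro B
    have hB : B ∈ Subgroup.closure
        (Set.range fun v : EuclideanSpace ℝ (Fin k) => (Submodule.span ℝ {v})ᗮ.reflection) := by
      rw [LinearIsometryEquiv.reflections_generate]; trivial
    induction hB using Subgroup.closure_induction with
    | one => exact ⟨1, by simp, 1, by simp, fun i u => by simp⟩
    | mul B C _ _ hB hC =>
      obtain ⟨W, hW, ε, hε, h⟩ := hB
      obtain ⟨W', hW', ε', hε', h'⟩ := hC
      refine ⟨W * W', by rw [Units.val_mul, mul_assoc, hW', ← mul_assoc, hW, mul_assoc], ε * ε',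
        by rw [mul_mul_mul_comm, hε, hε', one_mul], fun i u => ?_⟩
      rw [Units.val_mul, mul_assoc, h', mul_smul_comm, ← mul_assoc, h, smul_mul_assoc, smul_smul,
        mul_assoc, mul_comm ε' ε]
      rfl
    | inv B _ hB =>
      obtain ⟨W, hW, ε, hε, h⟩ := hB
      refine ⟨W⁻¹, ?_, ε, hε, fun i u => ?_⟩
      · rw [Units.inv_mul_eq_iff_eq_mul, ← mul_assoc, hW, mul_assoc, Units.mul_inv, mul_one]
      · rw [Units.inv_mul_eq_iff_eq_mul, mul_smul_comm, ← mul_assoc, h, smul_mul_assoc, smul_smul,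
          hε, one_smul, mul_assoc, Units.mul_inv, mul_one]
        have : B ((B⁻¹) (WithLp.toLp 2 u)) = WithLp.toLp 2 u := B.apply_symm_apply _
        rw [WithLp.toLp_ofLp, this]
    | mem B hB =>
      obtain ⟨v, rfl⟩ := hB
      -- The generating family of reflections is indexed by all vectors; the zero vector gives the
      -- identity.
      by_cases hv : v = 0
      · subst hv
        refine ⟨1, by simp, 1, by simp, fun i u => ?_⟩
        have h0 : (Submodule.span ℝ {(0 : EuclideanSpace ℝ (Fin k))})ᗮ.reflection
            (WithLp.toLp 2 u) = WithLp.toLp 2 u := by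
          rw [Submodule.reflection_orthogonal_apply, Submodule.reflection_singleton_apply]
          simp
        rw [h0]; simp
      · set w : EuclideanSpace ℝ (Fin k) := (‖v‖⁻¹ : ℝ) • v with hw
        have hnorm : ‖w‖ = 1 := by
          rw [hw, norm_smul, norm_inv, norm_norm, inv_mul_cancel₀ (norm_ne_zero_iff.2 hv)]
        have hspan : Submodule.span ℝ {v} = Submodule.span ℝ {w} :=
          (Submodule.span_singleton_smul_eq
            (IsUnit.mk0 _ (inv_ne_zero (norm_ne_zero_iff.2 hv))) v).symm
        have hdot : ∀ a b : EuclideanSpace ℝ (Fin k), inner ℝ a b = a.ofLp ⬝ᵥ b.ofLp := fun a b => by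
          simp [PiLp.inner_apply, dotProduct, mul_comm]
        have hw1 : w.ofLp ⬝ᵥ w.ofLp = 1 := by
          rw [← hdot, real_inner_self_eq_norm_sq, hnorm, one_pow]
        have hrefl : ∀ u, ((Submodule.span ℝ {v})ᗮ.reflection (WithLp.toLp 2 u)).ofLp =
            u - (2 * (w.ofLp ⬝ᵥ u)) • w.ofLp := by
          intro u
          simp only [hspan]
          rw [Submodule.reflection_orthogonal_apply, Submodule.reflection_singleton_apply, hnorm,
            hdot]
          ext j
          simp
          ring
        set l := (List.finRange d).map fun i => tens (Pi.single i (1 : ℝ)) w.ofLp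
        have hu : cprod l ∈ pinGroup (negEuclideanForm (d * k)) :=
          cprod_mem_pinGroup (isOrthonormalList_tens hw1).1
        refine ⟨pinGroup.toUnits ⟨cprod l, hu⟩, ?_, (-1) ^ d, ?_, fun i u => ?_⟩
        · change cprod l * (x : EuclideanClifford (d * k)) = x * cprod l
          -- Moving `x` past `∏ (eᵢ ⊗ w)` multiplies by all the eigenvalues `s i`; their product is
          -- the determinant, which is `1`.
          rw [spin_mul_cprod x _ s (fun i => hx i _), ← List.ofFn_eq_map, List.prod_ofFn, hs,
            one_smul]
        · rw [← mul_pow]; simp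
        · rw [hrefl]
          exact cprod_tens_mul_cvec hw1 i u
  obtain ⟨W, hW, ε, hε, h⟩ := key B
  let gu := spinGroup.toUnits g
  have hgu : (gu : EuclideanClifford (d * k)) = g := rfl
  -- Both `W` and `g` implement `1 ⊗ B`, the first up to `ε`. So `g⁻¹ W` commutes up to `ε` with all
  -- vectors and therefore commutes with the even element `x`; since `W` does too, so does `g`.
  have hz : ∀ v : Fin (d * k) → ℝ, ((gu⁻¹ * W : (EuclideanClifford (d * k))ˣ) : EuclideanClifford (d * k)) *
      cvec v = ε • (cvec v * ((gu⁻¹ * W : (EuclideanClifford (d * k))ˣ) :)) := by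
    intro v
    rw [eq_sum_tens v]
    simp only [map_sum, Finset.mul_sum, Finset.sum_mul, Finset.smul_sum]
    refine Finset.sum_congr rfl fun i _ => ?_
    rw [Units.val_mul, mul_assoc, h, ← hg, Units.inv_mul_eq_iff_eq_mul, mul_smul_comm, ← mul_assoc,
      ← mul_assoc, hgu, spinCover_spec, ← hgu, mul_assoc _ (gu : EuclideanClifford (d * k)),
      Units.mul_inv, mul_one]
  have hzx := commute_of_mem_even hε hz (spinGroup.mem_even x.2)
  refine Subtype.ext ?_
  rw [Submonoid.coe_mul, Submonoid.coe_mul, ← hgu]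
  have e : (gu : EuclideanClifford (d * k)) = W * ↑(gu⁻¹ * W)⁻¹ := by
    rw [← Units.val_mul]; congr 1; group
  have hzx' : (↑(gu⁻¹ * W)⁻¹ : EuclideanClifford (d * k)) * x =
      x * ↑(gu⁻¹ * W)⁻¹ := by
    rw [Units.inv_mul_eq_iff_eq_mul, ← mul_assoc, hzx, mul_assoc, Units.mul_inv, mul_one]
  rw [e, mul_assoc, hzx', ← mul_assoc, hW, mul_assoc]

end

/-! ### The representation `ρ ⊗ 1` and its commutant -/

/-- The endomorphism `A ⊗ 1` of `ℝᵈ ⊗ ℝᵏ`. -/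
def tensEnd {d : ℕ} (k : ℕ) (A : (Fin d → ℝ) →ₗ[ℝ] (Fin d → ℝ)) :
    (Fin (d * k) → ℝ) →ₗ[ℝ] (Fin (d * k) → ℝ) where
  toFun y p := A (fun i => y (finProdFinEquiv (i, (finProdFinEquiv.symm p).2)))
    (finProdFinEquiv.symm p).1
  map_add' y y' := by
    ext p
    exact congrFun (map_add A (fun i => y (finProdFinEquiv (i, (finProdFinEquiv.symm p).2)))
      fun i => y' (finProdFinEquiv (i, (finProdFinEquiv.symm p).2))) _
  map_smul' c y := by
    ext p
    exact congrFun (map_smul A c fun i => y (finProdFinEquiv (i, (finProdFinEquiv.symm p).2))) _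

theorem tensEnd_apply {d k : ℕ} (A : (Fin d → ℝ) →ₗ[ℝ] (Fin d → ℝ)) (y : Fin (d * k) → ℝ)
    (i : Fin d) (j : Fin k) : tensEnd k A y (finProdFinEquiv (i, j)) =
      A (fun i => y (finProdFinEquiv (i, j))) i := by
  change A (fun i' => y (finProdFinEquiv (i', (finProdFinEquiv.symm (finProdFinEquiv (i, j))).2)))
    (finProdFinEquiv.symm (finProdFinEquiv (i, j))).1 = _
  simp only [Equiv.symm_apply_apply]

theorem funext_finProd {d k : ℕ} {y y' : Fin (d * k) → ℝ}
    (h : ∀ i j, y (finProdFinEquiv (i, j)) = y' (finProdFinEquiv (i, j))) : y = y' := by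
  ext p
  obtain ⟨⟨i, j⟩, rfl⟩ := finProdFinEquiv.surjective p
  exact h i j

theorem tensEnd_tens {d k : ℕ} (A : (Fin d → ℝ) →ₗ[ℝ] (Fin d → ℝ)) (v : Fin d → ℝ)
    (u : Fin k → ℝ) : tensEnd k A (tens v u) = tens (A v) u := by
  refine funext_finProd fun i j => ?_
  rw [tensEnd_apply, tens_apply]
  simp only [tens_apply]
  have : (fun i => v i * u j) = u j • v := by ext; simp [mul_comm]
  rw [this, map_smul, Pi.smul_apply, smul_eq_mul, mul_comm]

theorem tensEnd_dotProduct {d k : ℕ} {A : (Fin d → ℝ) →ₗ[ℝ] (Fin d → ℝ)}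
    (hA : ∀ v w, A v ⬝ᵥ A w = v ⬝ᵥ w) (y y' : Fin (d * k) → ℝ) :
    tensEnd k A y ⬝ᵥ tensEnd k A y' = y ⬝ᵥ y' := by
  simp only [dotProduct] at hA ⊢
  rw [← finProdFinEquiv.sum_comp, ← finProdFinEquiv.sum_comp, Fintype.sum_prod_type_right,
    Fintype.sum_prod_type_right]
  refine Finset.sum_congr rfl fun j _ => ?_
  simp only [tensEnd_apply]
  exact hA _ _

theorem trace_eq_sum_single {m : ℕ} (A : (Fin m → ℝ) →ₗ[ℝ] (Fin m → ℝ)) :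
    LinearMap.trace ℝ _ A = ∑ i, A (Pi.single i 1) i := by
  rw [LinearMap.trace_eq_matrix_trace ℝ (Pi.basisFun ℝ _), Matrix.trace]
  refine Finset.sum_congr rfl fun i _ => ?_
  rw [Matrix.diag_apply, LinearMap.toMatrix_apply, Pi.basisFun_apply, Pi.basisFun_repr]

theorem trace_tensEnd {d k : ℕ} (A : (Fin d → ℝ) →ₗ[ℝ] (Fin d → ℝ)) :
    LinearMap.trace ℝ _ (tensEnd k A) = k * LinearMap.trace ℝ _ A := by
  rw [trace_eq_sum_single, trace_eq_sum_single, ← finProdFinEquiv.sum_comp,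
    Fintype.sum_prod_type_right]
  have : ∀ (i : Fin d) (j : Fin k),
      (fun i' => (Pi.single (finProdFinEquiv (i, j)) 1 : Fin (d * k) → ℝ)
        (finProdFinEquiv (i', j))) = Pi.single i 1 := by
    intro i j
    ext i'
    simp [Pi.single_apply]
  simp only [tensEnd_apply, this]
  simp

/-- The representation `ρ ⊗ 1` on `ℝᵈ ⊗ ℝᵏ`. -/
def tensRep {G : Type*} [Monoid G] {d : ℕ} (k : ℕ) (ρ : Representation ℝ G (Fin d → ℝ)) :
    Representation ℝ G (Fin (d * k) → ℝ) where
  toFun g := tensEnd k (ρ g)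
  map_one' := LinearMap.ext fun y => funext_finProd fun i j => by
    rw [map_one, tensEnd_apply]; rfl
  map_mul' g h := LinearMap.ext fun y => funext_finProd fun i j => by
    rw [map_mul, Module.End.mul_apply, tensEnd_apply, tensEnd_apply, Module.End.mul_apply]
    simp only [tensEnd_apply]

theorem tensRep_apply {G : Type*} [Monoid G] {d : ℕ} (k : ℕ)
    (ρ : Representation ℝ G (Fin d → ℝ)) (g : G) : tensRep k ρ g = tensEnd k (ρ g) := rfl

/-- An isometry of `ℝᵈ ⊗ ℝᵏ` commuting with `ρ ⊗ 1`, where `ρ` has scalar commutant, has the form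
`1 ⊗ B`. -/
theorem exists_isometry_of_commute_tensRep {G : Type*} [Monoid G] {d k : ℕ} (hd : 0 < d)
    {ρ : Representation ℝ G (Fin d → ℝ)}
    (hρ : ∀ T : (Fin d → ℝ) →ₗ[ℝ] (Fin d → ℝ), (∀ g v, T (ρ g v) = ρ g (T v)) →
      ∃ c : ℝ, ∀ v, T v = c • v)
    {T : (Fin (d * k) → ℝ) →ₗ[ℝ] (Fin (d * k) → ℝ)}
    (hT : ∀ g y, T (tensRep k ρ g y) = tensRep k ρ g (T y))
    (hdot : ∀ y y', T y ⬝ᵥ T y' = y ⬝ᵥ y') :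
    ∃ B : EuclideanSpace ℝ (Fin k) ≃ₗᵢ[ℝ] EuclideanSpace ℝ (Fin k),
      ∀ v u, T (tens v u) = tens v (B (WithLp.toLp 2 u)).ofLp := by
  -- Viewed as a `k × k` matrix of endomorphisms of `ℝᵈ`, the map `T` has blocks that commute with
  -- `ρ`, hence are scalars. These scalars form the matrix of `B`.
  let block : Fin k → Fin k → (Fin d → ℝ) →ₗ[ℝ] (Fin d → ℝ) := fun l j =>
    LinearMap.pi fun i => LinearMap.proj (finProdFinEquiv (i, l)) ∘ₗ T ∘ₗ
      tens.flip (Pi.single j 1)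
  have hblock : ∀ l j v i, block l j v i =
      T (tens v (Pi.single j 1)) (finProdFinEquiv (i, l)) := fun _ _ _ _ => rfl
  have hsc : ∀ l j, ∃ c : ℝ, ∀ v, block l j v = c • v := by
    intro l j
    refine hρ _ fun g v => ?_
    ext i
    rw [hblock, ← tensEnd_tens, ← tensRep_apply, hT, tensRep_apply, tensEnd_apply]
    rfl
  choose c hc using hsc
  let C : (Fin k → ℝ) →ₗ[ℝ] (Fin k → ℝ) := Matrix.toLin' (Matrix.of c)
  have hTC : ∀ v u, T (tens v u) = tens v (C u) := by
    intro v u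
    refine funext_finProd fun i l => ?_
    have hu : u = ∑ j, u j • (Pi.single j 1 : Fin k → ℝ) := pi_eq_sum_univ' u
    have h1 : ∀ j, T (tens v (Pi.single j 1)) (finProdFinEquiv (i, l)) = c l j * v i := fun j => by
      rw [← hblock, hc]; rfl
    conv_lhs => rw [hu]
    simp only [map_sum, map_smul, Finset.sum_apply, Pi.smul_apply, h1, tens_apply, smul_eq_mul, C,
      Matrix.toLin'_apply, Matrix.mulVec, dotProduct, Matrix.of_apply, Finset.mul_sum]
    exact Finset.sum_congr rfl fun j _ => by ring
  have hC : ∀ u, C u ⬝ᵥ C u = u ⬝ᵥ u := by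
    intro u
    have h := hdot (tens (Pi.single ⟨0, hd⟩ 1) u) (tens (Pi.single ⟨0, hd⟩ 1) u)
    rw [hTC, tens_dotProduct_tens, tens_dotProduct_tens] at h
    simpa using h
  let w := WithLp.linearEquiv 2 ℝ (Fin k → ℝ)
  let L : EuclideanSpace ℝ (Fin k) →ₗᵢ[ℝ] EuclideanSpace ℝ (Fin k) :=
    { toLinearMap := w.symm.toLinearMap ∘ₗ C ∘ₗ w.toLinearMap
      norm_map' := fun x => by
        rw [EuclideanSpace.norm_eq, EuclideanSpace.norm_eq]
        congr 1
        have := hC (w x)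
        simp only [dotProduct, ← pow_two] at this
        simp only [Real.norm_eq_abs, sq_abs]
        exact this }
  exact ⟨L.toLinearIsometryEquiv rfl, fun v u => hTC v u⟩

/-! ### Conjugacy classes and automorphisms of `Sym(8)` -/

section

open Equiv Equiv.Perm

/-- A set of representatives of the conjugacy classes of `Sym(8)`. -/
def permEightReps : List (Perm (Fin 8)) :=
  [1, c[0, 1], c[0, 1, 2], c[0, 1, 2, 3], c[0, 1, 2, 3, 4], c[0, 1, 2, 3, 4, 5],
    c[0, 1, 2, 3, 4, 5, 6], c[0, 1, 2, 3, 4, 5, 6, 7], c[0, 1] * c[2, 3], c[0, 1] * c[2, 3, 4],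
    c[0, 1] * c[2, 3, 4, 5], c[0, 1] * c[2, 3, 4, 5, 6], c[0, 1] * c[2, 3, 4, 5, 6, 7],
    c[0, 1, 2] * c[3, 4, 5], c[0, 1, 2] * c[3, 4, 5, 6], c[0, 1, 2] * c[3, 4, 5, 6, 7],
    c[0, 1, 2, 3] * c[4, 5, 6, 7], c[0, 1] * c[2, 3] * c[4, 5], c[0, 1] * c[2, 3] * c[4, 5, 6],
    c[0, 1] * c[2, 3] * c[4, 5, 6, 7], c[0, 1] * c[2, 3, 4] * c[5, 6, 7],
    c[0, 1] * c[2, 3] * c[4, 5] * c[6, 7]]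

/-- The list of cycle types is closed under adding a part as long as the sum stays at most `8`. This
is a finite check, and induction on the multiset does the rest. -/
theorem mem_map_cycleType_permEightReps {s : Multiset ℕ} (h2 : ∀ a ∈ s, 2 ≤ a) (h8 : s.sum ≤ 8) :
    s ∈ permEightReps.map cycleType := by
  have key : ∀ t ∈ permEightReps.map cycleType, ∀ a ∈ Finset.Icc 2 8,
      a + t.sum ≤ 8 → a ::ₘ t ∈ permEightReps.map cycleType := by decide +kernel
  induction s using Multiset.induction_on with
  | empty => exact List.mem_map.2 ⟨1, by simp [permEightReps], cycleType_one⟩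
  | cons a s ih =>
    rw [Multiset.sum_cons] at h8
    have ha := h2 a (Multiset.mem_cons_self a s)
    exact key s (ih (fun b hb => h2 b (Multiset.mem_cons_of_mem hb)) (by omega)) a
      (Finset.mem_Icc.2 ⟨ha, by omega⟩) h8

theorem exists_mem_permEightReps_isConj (σ : Perm (Fin 8)) : ∃ r ∈ permEightReps, IsConj r σ := by
  obtain ⟨r, hr, h⟩ := List.mem_map.1 (mem_map_cycleType_permEightReps
    (fun _ => two_le_of_mem_cycleType) ((sum_cycleType σ).trans_le (Finset.card_le_univ σ.support)))
  exact ⟨r, hr, isConj_iff_cycleType_eq.2 h⟩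

theorem swap_mul_swap_pow_six (a b c d : Fin 8) : (swap a b * swap c d) ^ 6 = 1 := by
  have key : ∀ c d : Fin 8, (swap (0 : Fin 8) 1 * swap c d) ^ 6 = 1 := by decide +kernel
  rcases eq_or_ne a b with rfl | hab
  · rw [swap_self, ← Perm.one_def, one_mul, pow_succ, pow_succ, pow_succ, pow_succ, pow_succ,
      pow_one]
    simp
  · obtain ⟨τ, hτ⟩ := isConj_iff.1 (Perm.isConj_swap (show (0 : Fin 8) ≠ 1 by decide) hab)
    have h2 : swap c d = τ * swap (τ⁻¹ c) (τ⁻¹ d) * τ⁻¹ := by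
      rw [mul_swap_eq_swap_mul]; simp
    rw [← hτ, h2, conj_mul, conj_pow, key]; simp

/-- For each of the other classes of involutions, conjugation by the single rotation `finRotate 8`
already produces a product whose order does not divide `6`. -/
theorem filter_permEightReps : permEightReps.filter (fun r => r ≠ 1 ∧ r * r = 1 ∧
    (r * (finRotate 8 * r * (finRotate 8)⁻¹)) ^ 6 = 1) = [swap 0 1] := by
  decide +kernel

/-- An involution in `Sym(8)` whose products with its conjugates have order dividing `6` is a
transposition. -/
theorem isSwap_of_conj_pow_six {σ : Perm (Fin 8)} (h1 : σ ≠ 1) (h2 : σ * σ = 1)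
    (h6 : ∀ τ : Perm (Fin 8), (σ * (τ * σ * τ⁻¹)) ^ 6 = 1) : σ.IsSwap := by
  obtain ⟨r, hr, hc⟩ := exists_mem_permEightReps_isConj σ
  obtain ⟨τ, rfl⟩ := isConj_iff.1 hc
  have h1' : r ≠ 1 := by rintro rfl; simp at h1
  have h2' : r * r = 1 := by
    rw [_root_.conj_mul, conj_eq_one_iff] at h2; exact h2
  have h6' : ∀ y : Perm (Fin 8), (r * (y * r * y⁻¹)) ^ 6 = 1 := fun y => by
    have := h6 (τ * y * τ⁻¹)
    have e : τ * r * τ⁻¹ * (τ * y * τ⁻¹ * (τ * r * τ⁻¹) * (τ * y * τ⁻¹)⁻¹) =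
        τ * (r * (y * r * y⁻¹)) * τ⁻¹ := by group
    rw [e, conj_pow, conj_eq_one_iff] at this
    exact this
  have hr' : r = swap 0 1 := by
    rw [← List.mem_singleton, ← filter_permEightReps, List.mem_filter]
    exact ⟨hr, decide_eq_true ⟨h1', h2', h6' _⟩⟩
  refine ⟨τ 0, τ 1, by simp, ?_⟩
  rw [hr', mul_swap_eq_swap_mul, mul_inv_cancel_right]

/-- A product of two transpositions has order `1`, `2` or `3`, and the criterion
`isSwap_of_conj_pow_six` is stated in terms of the group alone, so automorphisms preserve it. -/
theorem MulEquiv.map_swap_isSwap (α : Perm (Fin 8) ≃* Perm (Fin 8)) {a b : Fin 8} (hab : a ≠ b) :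
    (α (swap a b)).IsSwap := by
  refine isSwap_of_conj_pow_six ?_ ?_ fun τ => ?_
  · rw [Ne, EmbeddingLike.map_eq_one_iff, Perm.one_def, swap_eq_refl_iff]; exact hab
  · rw [← map_mul, swap_mul_self, map_one]
  · obtain ⟨τ, rfl⟩ := α.surjective τ
    rw [← map_inv, ← map_mul, ← map_mul, ← map_mul, ← map_pow, mul_swap_eq_swap_mul,
      mul_inv_cancel_right, swap_mul_swap_pow_six, map_one]

theorem Equiv.Perm.IsSwap.exists_of_not_commute {α : Type*} [DecidableEq α] {σ : Perm α}
    (h : σ.IsSwap) {p q : α} (hc : σ * swap p q ≠ swap p q * σ) :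
    ∃ z, z ≠ p ∧ z ≠ q ∧ (σ = swap p z ∨ σ = swap q z) := by
  obtain ⟨x, y, hxy, rfl⟩ := h
  by_cases hxp : x = p
  · subst hxp
    refine ⟨y, hxy.symm, ?_, Or.inl rfl⟩
    rintro rfl; exact hc rfl
  by_cases hxq : x = q
  · subst hxq
    refine ⟨y, ?_, hxy.symm, Or.inr rfl⟩
    rintro rfl; rw [swap_comm] at hc; exact hc rfl
  by_cases hyp : y = p
  · exact ⟨x, hxp, hxq, Or.inl (by rw [hyp, swap_comm])⟩
  by_cases hyq : y = q
  · exact ⟨x, hxp, hxq, Or.inr (by rw [hyq, swap_comm])⟩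
  refine absurd ?_ hc
  ext w
  simp only [Perm.mul_apply, swap_apply_def]
  grind

theorem swap_mul_swap_not_commute {α : Type*} [DecidableEq α] {a b c : α} (hab : a ≠ b)
    (hbc : b ≠ c) (hac : a ≠ c) : swap a b * swap a c ≠ swap a c * swap a b := by
  intro h
  have := Equiv.congr_fun h a
  simp only [Perm.mul_apply, swap_apply_left, swap_apply_of_ne_of_ne hac.symm hbc.symm,
    swap_apply_of_ne_of_ne hab.symm hbc] at this
  exact hbc this.symm

/-- Every automorphism of `Sym(8)` is inner. -/
theorem permEight_mulEquiv_inner (α : Perm (Fin 8) ≃* Perm (Fin 8)) :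
    ∃ τ : Perm (Fin 8), ∀ σ, α σ = τ * σ * τ⁻¹ := by
  have hS : ∀ j : Fin 8, j ≠ 0 → (α (swap 0 j)).IsSwap := fun j hj => α.map_swap_isSwap hj.symm
  have hne : ∀ i j : Fin 8, i ≠ 0 → j ≠ 0 → i ≠ j →
      α (swap 0 i) * α (swap 0 j) ≠ α (swap 0 j) * α (swap 0 i) := fun i j hi hj hij h => by
    rw [← map_mul, ← map_mul, α.injective.eq_iff] at h
    exact swap_mul_swap_not_commute hi.symm hij hj.symm h
  -- The transpositions `(0 1)` and `(0 2)` do not commute, so their images share exactly one point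
  -- `p`, the prospective image of `0`.
  obtain ⟨p, q, r, hpq, hpr, hqr, h1, h2⟩ : ∃ p q r : Fin 8, p ≠ q ∧ p ≠ r ∧ q ≠ r ∧
      α (swap 0 1) = swap p q ∧ α (swap 0 2) = swap p r := by
    obtain ⟨x, y, hxy, h1⟩ := hS 1 (by decide)
    obtain ⟨z, hzx, hzy, h2⟩ := (hS 2 (by decide)).exists_of_not_commute
      (p := x) (q := y) (h1 ▸ hne 2 1 (by decide) (by decide) (by decide))
    rcases h2 with h2 | h2
    · exact ⟨x, y, z, hxy, hzx.symm, hzy.symm, h1, h2⟩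
    · exact ⟨y, x, z, hxy.symm, hzy.symm, hzx.symm, by rw [h1, swap_comm], h2⟩
  -- Every `α (0 j)` moves `p`. Otherwise it would meet `(p q)` in `q` and `(p r)` in `r`, hence
  -- equal `(q r) = α (1 2)`, although `(0 j) ≠ (1 2)`.
  have hp : ∀ j : Fin 8, j ≠ 0 → ∃ b, b ≠ p ∧ α (swap 0 j) = swap p b := by
    intro j hj
    by_cases hj1 : j = 1
    · exact ⟨q, hpq.symm, by rw [hj1, h1]⟩
    by_cases hj2 : j = 2
    · exact ⟨r, hpr.symm, by rw [hj2, h2]⟩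
    obtain ⟨z, hzp, hzq, h3 | h3⟩ := (hS j hj).exists_of_not_commute
      (p := p) (q := q) (h1 ▸ hne j 1 hj (by decide) hj1)
    · exact ⟨z, hzp, h3⟩
    obtain ⟨w, hwp, hwr, h4 | h4⟩ := (hS j hj).exists_of_not_commute
      (p := p) (q := r) (h2 ▸ hne j 2 hj (by decide) hj2)
    · exact ⟨w, hwp, h4⟩
    exfalso
    have hwq : w = q := by
      have := Equiv.congr_fun (h3.symm.trans h4) w
      rw [swap_apply_right] at this
      by_contra hwq
      by_cases hwz : w = z
      · rw [hwz, swap_apply_right] at this; exact hqr this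
      · rw [swap_apply_of_ne_of_ne hwq hwz] at this; exact hwr this
    have h5 : α (swap 1 2) = α (swap 0 j) := by
      have e : (swap 1 2 : Perm (Fin 8)) = swap 0 1 * swap 0 2 * swap 0 1 := by decide
      rw [e, map_mul, map_mul, h1, h2, h4, hwq, swap_comm p r,
        swap_mul_swap_mul_swap hpr.symm hqr.symm, swap_comm]
    have h6 := Equiv.congr_fun (α.injective h5) 0
    rw [swap_apply_left, swap_apply_of_ne_of_ne (by decide) (by decide)] at h6
    exact hj h6.symm
  choose! b hb hα using hp
  let f : Fin 8 → Fin 8 := fun j => if j = 0 then p else b j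
  have hf : Function.Injective f := by
    intro i j hij
    by_cases hi : i = 0 <;> by_cases hj : j = 0
    · rw [hi, hj]
    · simp only [f, hi, hj, if_true, if_false] at hij; exact absurd hij.symm (hb j hj)
    · simp only [f, hi, hj, if_true, if_false] at hij; exact absurd hij (hb i hi)
    · simp only [f, hi, hj, if_false] at hij
      have h : α (swap 0 i) = α (swap 0 j) := by rw [hα i hi, hα j hj, hij]
      simpa using Equiv.congr_fun (α.injective h) 0
  let τ : Perm (Fin 8) := Equiv.ofBijective f (Finite.injective_iff_bijective.1 hf)
  have h0 : ∀ j, j ≠ 0 → α (swap 0 j) = τ * swap 0 j * τ⁻¹ := fun j hj => by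
    rw [mul_swap_eq_swap_mul, mul_inv_cancel_right, hα j hj]
    simp [τ, f, hj]
  have h00 : ∀ j, α (swap 0 j) = τ * swap 0 j * τ⁻¹ := fun j => by
    by_cases hj : j = 0
    · subst hj; rw [swap_self, ← Perm.one_def]; simp
    · exact h0 j hj
  refine ⟨τ, fun σ => ?_⟩
  induction σ using swap_induction_on with
  | one => simp
  | swap_mul σ x y hxy ih =>
    rw [map_mul, ih]
    have : α (swap x y) = τ * swap x y * τ⁻¹ := by
      by_cases hx : x = 0
      · rw [hx]; exact h00 y
      by_cases hy : y = 0
      · rw [hy, swap_comm]; exact h00 x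
      · have e : swap x y = swap 0 x * swap 0 y * swap 0 x := by
          rw [swap_comm 0 y, swap_mul_swap_mul_swap hy hxy.symm]
        rw [e, map_mul, map_mul, h00, h00]; group
    rw [this]; group

/-! ### Polytabloid coefficients as determinants -/

/-- The coefficient at the tabloid with entries `y` in the rows `1, …, 4` of the polytabloid with
first column `a`. -/
def hookDet (a : Fin 5 → Fin 8) (y : Fin 4 → Fin 8) : ℤ :=
  (Matrix.of (Fin.cons (fun _ => 1) fun r s => if y r = a s then 1 else 0 :
    Fin 5 → Fin 5 → ℤ)).det

theorem hookDet_comp_perm_left (σ : Perm (Fin 8)) (a : Fin 5 → Fin 8) (y : Fin 4 → Fin 8) :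
    hookDet (σ ∘ a) y = hookDet a ((σ⁻¹ : Perm (Fin 8)) ∘ y) := by
  unfold hookDet
  congr 2
  ext r s
  refine Fin.cases rfl (fun r => ?_) r
  simp [Equiv.symm_apply_eq]

theorem hookDet_comp_perm (a : Fin 5 → Fin 8) (π : Perm (Fin 5)) (y : Fin 4 → Fin 8) :
    hookDet (a ∘ π) y = (sign π : ℤ) * hookDet a y := by
  unfold hookDet
  rw [← Int.cast_id (n := (sign π : ℤ)), ← Matrix.det_permute']
  congr 1
  ext r s
  refine Fin.cases ?_ (fun r => ?_) r <;> rfl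

theorem hookDet_perm (a : Fin 5 → Fin 8) (π : Perm (Fin 4)) (y : Fin 4 → Fin 8) :
    hookDet a (y ∘ π) = (sign π : ℤ) * hookDet a y := by
  unfold hookDet
  have h : sign π = sign (decomposeFin.symm (0, π)) := by simp
  rw [h, ← Int.cast_id (n := ((sign (decomposeFin.symm (0, π)) : ℤˣ) : ℤ)),
    ← Matrix.det_permute]
  congr 1
  ext r s
  refine Fin.cases ?_ (fun r => ?_) r
  · simp
  · simp

theorem hookDet_eq_zero_of_left {a : Fin 5 → Fin 8} (ha : ¬ Function.Injective a)
    (y : Fin 4 → Fin 8) : hookDet a y = 0 := by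
  rw [Function.not_injective_iff] at ha
  obtain ⟨i, j, h, hij⟩ := ha
  refine Matrix.det_zero_of_column_eq hij fun r => ?_
  refine Fin.cases ?_ (fun r => ?_) r
  · rfl
  · simp [h]

theorem hookDet_eq_zero_of_right (a : Fin 5 → Fin 8) {y : Fin 4 → Fin 8}
    (hy : ¬ Function.Injective y) : hookDet a y = 0 := by
  rw [Function.not_injective_iff] at hy
  obtain ⟨i, j, h, hij⟩ := hy
  refine Matrix.det_zero_of_row_eq (i := i.succ) (j := j.succ) (by simpa using hij) ?_
  ext s
  simp [h]

theorem hookDet_eq_zero_of_not_mem {a : Fin 5 → Fin 8} {y : Fin 4 → Fin 8} (r : Fin 4)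
    (h : ∀ s, y r ≠ a s) : hookDet a y = 0 :=
  Matrix.det_eq_zero_of_row_eq_zero r.succ fun s => by simp [h s]

theorem hookDet_comp_succ {a : Fin 5 → Fin 8} (ha : Function.Injective a) :
    hookDet a (a ∘ Fin.succ) = 1 := by
  unfold hookDet
  rw [Matrix.det_of_isUpperTriangular]
  · rw [Fin.prod_univ_succ]; simp
  · intro i j hij
    obtain ⟨i, rfl⟩ := Fin.exists_succ_eq.2 (Fin.ne_zero_of_lt (show j < i from hij))
    simp [ha.eq_iff, (show j < i.succ from hij).ne']

/-- The index `b` enters only one row, and the sum of that row over all `b` is a row of ones. By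
multilinearity the sum is a determinant with two equal rows. -/
theorem sum_hookDet_cons (a : Fin 5 → Fin 8) (z : Fin 3 → Fin 8) :
    ∑ b, hookDet a (Fin.cons b z) = 0 := by
  by_cases ha : Function.Injective a
  swap; · simp [hookDet_eq_zero_of_left ha]
  let M : Matrix (Fin 5) (Fin 5) ℤ := Fin.cons (fun _ => 1) (Fin.cons (fun _ => 1)
    fun r s => if z r = a s then 1 else 0)
  let g : Fin 8 → Fin 5 → ℤ := fun b s => if b = a s then 1 else 0
  have h1 : ∀ b, hookDet a (Fin.cons b z) = Matrix.detRowAlternating (Function.update M 1 (g b)) := by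
    intro b
    unfold hookDet
    change Matrix.detRowAlternating _ = _
    congr 1
    ext r s
    fin_cases r <;> rfl
  have h2 := (Matrix.detRowAlternating (R := ℤ) (n := Fin 5)).toMultilinearMap.map_update_sum
    Finset.univ 1 g M
  simp only [h1]
  refine h2.symm.trans ?_
  refine Matrix.detRowAlternating.map_eq_zero_of_eq _ (i := 0) (j := 1) ?_ (by decide)
  ext s
  simp [M, g]

theorem strictMono_range_subset_eq {x x' : Fin 4 → Fin 7} (hx : StrictMono x)
    (hx' : StrictMono x') (h : ∀ r, ∃ s, x' r = x s) : x' = x := by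
  refine (hx'.range_inj hx).1 (Set.eq_of_subset_of_ncard_le ?_ ?_)
  · rintro _ ⟨r, rfl⟩
    obtain ⟨s, hs⟩ := h r
    exact ⟨s, hs.symm⟩
  · rw [Set.ncard_range_of_injective hx.injective, Set.ncard_range_of_injective hx'.injective]

/-- If `x' ≠ x`, some entry of `x'` is not an entry of `x`, and its row vanishes; if `x' = x`, the
matrix is triangular with ones on the diagonal. So these polytabloids are dual to evaluation at
increasing sequences. -/
theorem hookDet_cons_zero {x x' : Fin 4 → Fin 7} (hx : StrictMono x)
    (hx' : StrictMono x') :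
    hookDet (Fin.cons 0 (Fin.succ ∘ x)) (Fin.succ ∘ x') = if x = x' then 1 else 0 := by
  split_ifs with h
  · subst h
    refine hookDet_comp_succ (a := Fin.cons 0 (Fin.succ ∘ x)) ?_
    rw [Fin.cons_injective_iff]
    exact ⟨by simp, (Fin.succ_injective _).comp hx.injective⟩
  · by_cases h2 : ∀ r, ∃ s, x' r = x s
    · exact absurd (strictMono_range_subset_eq hx hx' h2).symm h
    · push Not at h2
      obtain ⟨r, hr⟩ := h2
      refine hookDet_eq_zero_of_not_mem r fun s => ?_
      refine Fin.cases ?_ (fun s => ?_) s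
      · exact Fin.succ_ne_zero _
      · simpa using hr s

/-- The cyclic group generated by `r` has an orbit sum and an alternating orbit sum of polytabloids
that do not vanish. -/
def HasNonzeroOrbitSums (r : Perm (Fin 8)) : Prop :=
  ∃ N ∈ [2, 4, 6, 8, 10, 12], r ^ N = 1 ∧
    (∑ j ∈ Finset.range N, hookDet ((r ^ j : Perm (Fin 8)) ∘ ![0, 2, 3, 4, 7]) ![0, 2, 3, 4]) ≠ 0 ∧
    (∑ j ∈ Finset.range N,
      (-1) ^ j * hookDet ((r ^ j : Perm (Fin 8)) ∘ ![0, 2, 3, 4, 7]) ![0, 2, 3, 4]) ≠ 0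

instance : DecidablePred HasNonzeroOrbitSums := fun r => by
  unfold HasNonzeroOrbitSums; infer_instance

/-- One column and one coefficient serve for every odd class. Odd permutations in `Sym(8)` have even
order at most `12`, which explains the list of exponents `N`. -/
theorem filter_hasNonzeroOrbitSums :
    permEightReps.filter (fun r => sign r = -1 ∧ ¬ HasNonzeroOrbitSums r) = [] := by
  decide +kernel

theorem hasNonzeroOrbitSums_of_sign {r : Perm (Fin 8)} (hr : r ∈ permEightReps)
    (hs : sign r = -1) : HasNonzeroOrbitSums r := by
  by_contra h
  have : r ∈ permEightReps.filter (fun r => sign r = -1 ∧ ¬ HasNonzeroOrbitSums r) :=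
    List.mem_filter.2 ⟨hr, decide_eq_true ⟨hs, h⟩⟩
  rw [filter_hasNonzeroOrbitSums] at this
  exact List.not_mem_nil this

/-- The increasing sequences of length `4` in `{0, …, 6}`. -/
abbrev IncreasingFour : Type := {x : Fin 4 → Fin 7 // x 0 < x 1 ∧ x 1 < x 2 ∧ x 2 < x 3}

theorem card_increasingFour : Fintype.card IncreasingFour = 35 := by decide +kernel

/-- These sums are character values of the exterior fourth power of the `7`-dimensional reflection
representation: a transposition gives `15 - 20`. -/
theorem sum_hookDet_swap : ∑ x : IncreasingFour,
    hookDet (swap (1 : Fin 8) 2 ∘ Fin.cons 0 (Fin.succ ∘ x.1)) (Fin.succ ∘ x.1) = -5 := by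
  decide +kernel

theorem sum_hookDet_swap_mul_swap : ∑ x : IncreasingFour,
    hookDet ((swap (1 : Fin 8) 2 * swap 3 4 : Perm (Fin 8)) ∘ Fin.cons 0 (Fin.succ ∘ x.1))
      (Fin.succ ∘ x.1) = -5 := by
  decide +kernel

/-! ### A model of the Specht module in functions of four indices -/

/-- The real functions on the sequences of length `4` in `{0, …, 7}`. -/
abbrev FourFun : Type := EuclideanSpace ℝ (Fin 4 → Fin 8)

/-- The permutation representation of `Sym(8)` on functions of four indices. -/
def fourRep : Representation ℝ (Perm (Fin 8)) FourFun where
  toFun σ :=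
    { toFun := fun f => WithLp.toLp 2 fun y => f ((σ⁻¹ : Perm (Fin 8)) ∘ y)
      map_add' := fun _ _ => rfl
      map_smul' := fun _ _ => rfl }
  map_one' := rfl
  map_mul' σ τ := by
    ext f y
    simp only [mul_inv_rev]
    rfl

theorem fourRep_apply (σ : Perm (Fin 8)) (f : FourFun) (y : Fin 4 → Fin 8) :
    fourRep σ f y = f ((σ⁻¹ : Perm (Fin 8)) ∘ y) := rfl

theorem inner_fourRep (σ : Perm (Fin 8)) (f g : FourFun) :
    inner ℝ (fourRep σ f) (fourRep σ g) = inner ℝ f g := by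
  simp only [PiLp.inner_apply]
  exact ((Equiv.refl (Fin 4)).arrowCongr (σ⁻¹ : Perm (Fin 8))).sum_comp
    fun y => inner ℝ (f y) (g y)

/-- The polytabloid with first column `a`, as a function of the entries in the rows `1, …, 4`. -/
def hookVec (a : Fin 5 → Fin 8) : FourFun := WithLp.toLp 2 fun y => (hookDet a y : ℝ)

theorem hookVec_apply (a : Fin 5 → Fin 8) (y : Fin 4 → Fin 8) : hookVec a y = hookDet a y := rfl

theorem fourRep_hookVec (σ : Perm (Fin 8)) (a : Fin 5 → Fin 8) :
    fourRep σ (hookVec a) = hookVec (σ ∘ a) := by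
  ext y
  rw [fourRep_apply, hookVec_apply, hookVec_apply, hookDet_comp_perm_left]

theorem hookVec_comp_perm (a : Fin 5 → Fin 8) (π : Perm (Fin 5)) :
    hookVec (a ∘ π) = ((sign π : ℤ) : ℝ) • hookVec a := by
  ext y
  simp [hookVec_apply, hookDet_comp_perm]

theorem hookVec_eq_zero {a : Fin 5 → Fin 8} (ha : ¬ Function.Injective a) : hookVec a = 0 := by
  ext y
  simp [hookVec_apply, hookDet_eq_zero_of_left ha]

/-- The span of the polytabloids of shape `(4, 1, 1, 1, 1)`. -/
def hookSub : Subrepresentation fourRep where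
  toSubmodule := Submodule.span ℝ (Set.range hookVec)
  apply_mem_toSubmodule σ v hv := by
    induction hv using Submodule.span_induction with
    | mem v hv =>
      obtain ⟨a, rfl⟩ := hv
      rw [fourRep_hookVec]
      exact Submodule.subset_span ⟨_, rfl⟩
    | zero => rw [map_zero]; exact Submodule.zero_mem _
    | add v w _ _ hv hw => rw [map_add]; exact Submodule.add_mem _ hv hw
    | smul c v _ hv => rw [map_smul]; exact Submodule.smul_mem _ c hv

abbrev hookSpace : Submodule ℝ FourFun := hookSub.toSubmodule

/-- The representation of `Sym(8)` on the span of the polytabloids. -/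
abbrev hookRep : Representation ℝ (Perm (Fin 8)) hookSpace := hookSub.toRepresentation

theorem hookVec_mem (a : Fin 5 → Fin 8) : hookVec a ∈ hookSpace :=
  Submodule.subset_span ⟨a, rfl⟩

theorem coe_hookRep (σ : Perm (Fin 8)) (f : hookSpace) :
    (hookRep σ f : FourFun) = fourRep σ f := rfl

theorem hookSpace_comp_perm {f : FourFun} (hf : f ∈ hookSpace) (π : Perm (Fin 4))
    (y : Fin 4 → Fin 8) : f (y ∘ π) = ((sign π : ℤ) : ℝ) * f y := by
  induction hf using Submodule.span_induction with
  | mem f hf => obtain ⟨a, rfl⟩ := hf; simp [hookVec_apply, hookDet_perm]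
  | zero => simp
  | add f g _ _ hf hg => simp only [PiLp.add_apply, hf, hg, mul_add]
  | smul c f _ hf => simp only [PiLp.smul_apply, hf, smul_eq_mul]; ring

theorem hookSpace_eq_zero {f : FourFun} (hf : f ∈ hookSpace) {y : Fin 4 → Fin 8}
    (hy : ¬ Function.Injective y) : f y = 0 := by
  induction hf using Submodule.span_induction with
  | mem f hf => obtain ⟨a, rfl⟩ := hf; simp [hookVec_apply, hookDet_eq_zero_of_right a hy]
  | zero => simp
  | add f g _ _ hf hg => simp [hf, hg]
  | smul c f _ hf => simp [hf]

theorem hookSpace_sum_cons {f : FourFun} (hf : f ∈ hookSpace) (z : Fin 3 → Fin 8) :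
    ∑ b, f (Fin.cons b z) = 0 := by
  induction hf using Submodule.span_induction with
  | mem f hf =>
    obtain ⟨a, rfl⟩ := hf
    simp only [hookVec_apply]
    exact_mod_cast sum_hookDet_cons a z
  | zero => simp
  | add f g _ _ hf hg => simp [Finset.sum_add_distrib, hf, hg]
  | smul c f _ hf => simp [← Finset.mul_sum, hf]

theorem increasingFour_strictMono (x : IncreasingFour) : StrictMono x.1 := by
  rw [Fin.strictMono_iff_lt_succ]
  intro i
  fin_cases i
  · exact x.2.1
  · exact x.2.2.1
  · exact x.2.2.2

/-! ### Dimension and character -/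

/-- The values of a function in `hookSpace` at increasing sequences of nonzero indices. -/
def hookCoord : hookSpace →ₗ[ℝ] (IncreasingFour → ℝ) where
  toFun f x := (f : FourFun) (Fin.succ ∘ x.1)
  map_add' _ _ := rfl
  map_smul' _ _ := rfl

theorem hookCoord_apply (f : hookSpace) (x : IncreasingFour) :
    hookCoord f x = (f : FourFun) (Fin.succ ∘ x.1) := rfl

/-- A function in `hookSpace` is alternating and its sum over the first index vanishes. Sorting
reduces nonzero indices to increasing ones, and the sum relation expresses a value with first index
`0` through values with nonzero indices. -/
theorem hookCoord_injective : Function.Injective hookCoord := by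
  rw [← LinearMap.ker_eq_bot, LinearMap.ker_eq_bot']
  rintro ⟨f, hf⟩ h0
  have h1 : ∀ y : Fin 4 → Fin 8, (∀ i, y i ≠ 0) → f y = 0 := by
    intro y hy
    by_cases hinj : Function.Injective y
    swap; · exact hookSpace_eq_zero hf hinj
    choose x hx using fun i => Fin.exists_succ_eq.2 (hy i)
    have hxy : y = Fin.succ ∘ x := funext fun i => (hx i).symm
    have hxinj : Function.Injective x := by
      rw [hxy] at hinj; exact hinj.of_comp
    have hmono : StrictMono (x ∘ Tuple.sort x) :=
      (Tuple.monotone_sort x).strictMono_of_injective (hxinj.comp (Tuple.sort x).injective)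
    have h2 := congrFun h0 ⟨x ∘ Tuple.sort x, hmono (by decide), hmono (by decide),
      hmono (by decide)⟩
    have h3 : f (Fin.succ ∘ x ∘ Tuple.sort x) = 0 := h2
    rw [← Function.comp_assoc, hookSpace_comp_perm hf, ← hxy] at h3
    rcases Int.units_eq_one_or (sign (Tuple.sort x)) with h | h <;> simpa [h] using h3
  have h2 : ∀ z : Fin 3 → Fin 8, f (Fin.cons 0 z) = 0 := by
    intro z
    by_cases hz : ∃ i, z i = 0
    · obtain ⟨i, hi⟩ := hz
      refine hookSpace_eq_zero hf fun h => ?_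
      exact absurd (@h 0 i.succ (by simp [hi])) (Fin.succ_ne_zero i).symm
    · push Not at hz
      have h := hookSpace_sum_cons hf z
      rw [Fin.sum_univ_succ] at h
      rwa [Finset.sum_eq_zero, add_zero] at h
      intro b _
      refine h1 _ fun i => ?_
      refine Fin.cases ?_ (fun i => ?_) i
      · exact Fin.succ_ne_zero b
      · exact hz i
  refine Subtype.ext ?_
  ext y
  change f y = 0
  by_cases hy : ∃ i, y i = 0
  · obtain ⟨i, hi⟩ := hy
    have h3 : y ∘ swap 0 i = Fin.cons 0 (Fin.tail (y ∘ swap 0 i)) := by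
      conv_lhs => rw [← Fin.cons_self_tail (y ∘ swap 0 i)]
      congr 1
    have h4 := hookSpace_comp_perm hf (swap 0 i) y
    rw [h3, h2] at h4
    rcases Int.units_eq_one_or (sign (swap 0 i)) with h | h <;> simpa [h] using h4.symm
  · push Not at hy
    exact h1 y hy

/-- The polytabloid of the column with entries `0` and those of `x`. -/
def hookBasisVec (x : IncreasingFour) : hookSpace :=
  ⟨hookVec (Fin.cons 0 (Fin.succ ∘ x.1)), hookVec_mem _⟩

theorem hookCoord_hookBasisVec (x : IncreasingFour) :
    hookCoord (hookBasisVec x) = Pi.single x 1 := by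
  ext x'
  rw [hookCoord_apply, hookBasisVec, hookVec_apply, hookDet_cons_zero (increasingFour_strictMono x)
    (increasingFour_strictMono x'), Pi.single_apply]
  simp [Subtype.ext_iff, eq_comm]

theorem hookCoord_surjective : Function.Surjective hookCoord := by
  intro c
  refine ⟨∑ x, c x • hookBasisVec x, ?_⟩
  simp only [map_sum, map_smul, hookCoord_hookBasisVec]
  ext x
  simp [Finset.sum_apply, Pi.single_apply]

def hookCoordEquiv : hookSpace ≃ₗ[ℝ] (IncreasingFour → ℝ) :=
  LinearEquiv.ofBijective hookCoord ⟨hookCoord_injective, hookCoord_surjective⟩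

theorem finrank_hookSpace : Module.finrank ℝ hookSpace = 35 := by
  rw [hookCoordEquiv.finrank_eq, Module.finrank_fintype_fun_eq_card, card_increasingFour]

/-- The vectors `hookBasisVec x` are dual to the coordinates, so the diagonal entries are
coefficients of permuted polytabloids. -/
theorem trace_hookRep (σ : Perm (Fin 8)) : LinearMap.trace ℝ hookSpace (hookRep σ) =
    ((∑ x : IncreasingFour,
      hookDet (σ ∘ Fin.cons 0 (Fin.succ ∘ x.1)) (Fin.succ ∘ x.1) : ℤ) : ℝ) := by
  rw [← LinearMap.trace_conj' _ hookCoordEquiv, LinearMap.trace_eq_matrix_trace ℝ (Pi.basisFun ℝ _),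
    Matrix.trace, Int.cast_sum]
  refine Finset.sum_congr rfl fun x _ => ?_
  have h : hookCoordEquiv.symm (Pi.single x 1) = hookBasisVec x := by
    rw [LinearEquiv.symm_apply_eq, ← hookCoord_hookBasisVec]; rfl
  rw [Matrix.diag_apply, LinearMap.toMatrix_apply, Pi.basisFun_apply, Pi.basisFun_repr,
    LinearEquiv.conj_apply_apply, h]
  change (fourRep σ (hookVec _)) _ = _
  rw [fourRep_hookVec, hookVec_apply]

theorem trace_hookRep_of_isConj {σ τ : Perm (Fin 8)} (h : IsConj σ τ) :
    LinearMap.trace ℝ hookSpace (hookRep τ) = LinearMap.trace ℝ hookSpace (hookRep σ) := by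
  obtain ⟨c, rfl⟩ := isConj_iff.1 h
  rw [map_mul, LinearMap.trace_mul_comm, ← map_mul, inv_mul_cancel_left]

theorem trace_hookRep_swap {a b : Fin 8} (hab : a ≠ b) :
    LinearMap.trace ℝ hookSpace (hookRep (swap a b)) = -5 := by
  rw [trace_hookRep_of_isConj (isConj_swap (show (1 : Fin 8) ≠ 2 by decide) hab), trace_hookRep,
    sum_hookDet_swap]
  norm_num

theorem trace_hookRep_swap_mul_swap {a b c d : Fin 8} (hab : a ≠ b) (hcd : c ≠ d)
    (h : Perm.Disjoint (swap a b) (swap c d)) :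
    LinearMap.trace ℝ hookSpace (hookRep (swap a b * swap c d)) = -5 := by
  have hc : IsConj (swap (1 : Fin 8) 2 * swap 3 4) (swap a b * swap c d) := by
    rw [isConj_iff_cycleType_eq, h.cycleType_mul, (swap_isSwap_iff.2 hab).isCycle.cycleType,
      (swap_isSwap_iff.2 hcd).isCycle.cycleType, card_support_swap hab, card_support_swap hcd]
    decide +kernel
  rw [trace_hookRep_of_isConj hc, trace_hookRep, sum_hookDet_swap_mul_swap]
  norm_num

/-! ### Commutant, faithfulness and eigenvectors -/

theorem fourRep_swap_hookVec {a : Fin 5 → Fin 8} (ha : Function.Injective a) {i j : Fin 5}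
    (hij : i ≠ j) : fourRep (swap (a i) (a j)) (hookVec a) = -hookVec a := by
  rw [fourRep_hookVec, ha.swap_comp, hookVec_comp_perm, sign_swap hij]
  simp

/-- The functions in `hookSpace` that are antisymmetric under the permutations of the entries of
`a` are the multiples of the polytabloid of `a`. -/
theorem eq_smul_hookVec {w : FourFun} (hw : w ∈ hookSpace) {a : Fin 5 → Fin 8}
    (ha : Function.Injective a)
    (hanti : ∀ i j, i ≠ j → fourRep (swap (a i) (a j)) w = -w) :
    w = w (a ∘ Fin.succ) • hookVec a := by
  -- The difference has the same antisymmetry and vanishes at `a ∘ Fin.succ`; it has to vanish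
  -- everywhere.
  set w' := w - w (a ∘ Fin.succ) • hookVec a with hw'def
  have hw' : w' ∈ hookSpace := sub_mem hw (Submodule.smul_mem _ _ (hookVec_mem a))
  have hanti' : ∀ i j, i ≠ j → ∀ y, w' (swap (a i) (a j) ∘ y) = -w' y := by
    intro i j hij y
    have h : fourRep (swap (a i) (a j)) w' = -w' := by
      rw [hw'def, map_sub, map_smul, hanti i j hij, fourRep_swap_hookVec ha hij, smul_neg,
        sub_neg_eq_add, neg_sub, neg_add_eq_sub]
    have h2 := congrArg (fun f : FourFun => f y) h
    simpa [fourRep_apply] using h2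
  have h0 : w' (a ∘ Fin.succ) = 0 := by
    simp [hw'def, hookVec_apply, hookDet_comp_succ ha]
  have h1 : ∀ π : Perm (Fin 5), w' (a ∘ π ∘ Fin.succ) = 0 := by
    intro π
    induction π using swap_induction_on with
    | one => exact h0
    | swap_mul π x y hxy ih =>
      have : a ∘ (swap x y * π : Perm (Fin 5)) ∘ Fin.succ =
          swap (a x) (a y) ∘ (a ∘ π ∘ Fin.succ) := by
        rw [← Function.comp_assoc (swap (a x) (a y)), ha.swap_comp]; rfl
      rw [this, hanti' x y hxy, ih, neg_zero]
  rw [← sub_eq_zero]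
  ext y
  change w' y = 0
  by_cases hy : Function.Injective y
  swap; · exact hookSpace_eq_zero hw' hy
  by_cases hr : ∀ r, ∃ s, a s = y r
  · choose q hq using hr
    have hyq : y = a ∘ q := funext fun r => (hq r).symm
    have hqinj : Function.Injective q := by rw [hyq] at hy; exact hy.of_comp
    have hqs : ¬ Function.Surjective q := fun h => by
      simpa using Fintype.card_le_of_surjective q h
    -- The four positions miss one position `c` of the column; putting it first completes them to a
    -- permutation of the column, where `w'` is known to vanish.
    rw [Function.Surjective] at hqs
    push Not at hqs
    obtain ⟨c, hc⟩ := hqs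
    have hbij : Function.Bijective (Fin.cons c q : Fin 5 → Fin 5) := by
      rw [← Finite.injective_iff_bijective, Fin.cons_injective_iff]
      exact ⟨by rintro ⟨r, hr⟩; exact hc r hr, hqinj⟩
    have h2 := h1 (Equiv.ofBijective _ hbij)
    rw [hyq]
    exact h2
  · push Not at hr
    obtain ⟨r, hr⟩ := hr
    -- If some entry of `y` is outside the column, `y` meets at most three of its five entries.
    -- Swapping two entries that `y` misses fixes `y` and changes the sign of `w'`, so `w' y = 0`.
    let H : Finset (Fin 5) := Finset.univ.filter fun s => ∃ r', y r' = a s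
    have hH : H.card ≤ 3 := by
      have hsub : H.image a ⊆ (Finset.univ.erase r).image y := by
        intro b hb
        obtain ⟨s, hs, rfl⟩ := Finset.mem_image.1 hb
        obtain ⟨r', hr'⟩ := (Finset.mem_filter.1 hs).2
        refine Finset.mem_image.2 ⟨r', Finset.mem_erase.2 ⟨?_, Finset.mem_univ _⟩, hr'⟩
        rintro rfl
        exact hr s hr'.symm
      rw [← Finset.card_image_of_injective H ha]
      exact (Finset.card_le_card hsub).trans (Finset.card_image_le.trans (by simp))
    have hHc : 1 < Hᶜ.card := by
      rw [Finset.card_compl, Fintype.card_fin]; omega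
    obtain ⟨i, hi, j, hj, hij⟩ := Finset.one_lt_card.1 hHc
    have hni : ∀ r', y r' ≠ a i := fun r' h => by simp [H] at hi; exact hi r' h
    have hnj : ∀ r', y r' ≠ a j := fun r' h => by simp [H] at hj; exact hj r' h
    have h3 : swap (a i) (a j) ∘ y = y :=
      funext fun r' => swap_apply_of_ne_of_ne (hni r') (hnj r')
    have h4 := hanti' i j hij y
    rw [h3] at h4
    linarith

theorem exists_perm_comp_eq {n N : ℕ} {a b : Fin n → Fin N} (ha : Function.Injective a)
    (hb : Function.Injective b) : ∃ σ : Perm (Fin N), σ ∘ a = b := by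
  have : MulAction.IsPretransitive (Perm (Fin N)) (Fin n ↪ Fin N) :=
    Equiv.Perm.isMultiplyPretransitive (Fin N) n
  obtain ⟨σ, hσ⟩ := MulAction.exists_smul_eq (Perm (Fin N))
    (⟨a, ha⟩ : Fin n ↪ Fin N) (⟨b, hb⟩ : Fin n ↪ Fin N)
  exact ⟨σ, congrArg DFunLike.coe hσ⟩

/-- The commutant of the representation `hookRep` consists of the scalars. -/
theorem hookRep_commutant {T : hookSpace →ₗ[ℝ] hookSpace}
    (hT : ∀ σ v, T (hookRep σ v) = hookRep σ (T v)) : ∃ c : ℝ, ∀ v, T v = c • v := by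
  let a : Fin 5 → Fin 8 := Fin.castLE (by norm_num)
  have ha : Function.Injective a := Fin.castLE_injective _
  let e : (Fin 5 → Fin 8) → hookSpace := fun b => ⟨hookVec b, hookVec_mem b⟩
  have he : ∀ (σ : Perm (Fin 8)) b, hookRep σ (e b) = e (σ ∘ b) := fun σ b =>
    Subtype.ext (fourRep_hookVec σ b)
  -- Antisymmetry in the column of `a` determines `hookVec a` up to a scalar, and `T` preserves it.
  -- The scalar is the same for all columns because `Sym(8)` permutes the injective ones
  -- transitively.
  have h1 : (T (e a) : FourFun) = (T (e a) : FourFun) (a ∘ Fin.succ) • hookVec a := by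
    refine eq_smul_hookVec (T (e a)).2 ha fun i j hij => ?_
    rw [← coe_hookRep, ← hT]
    have : hookRep (swap (a i) (a j)) (e a) = -e a := Subtype.ext (fourRep_swap_hookVec ha hij)
    rw [this, map_neg]; rfl
  set c := (T (e a) : FourFun) (a ∘ Fin.succ)
  have h2 : T (e a) = c • e a := Subtype.ext h1
  have h3 : ∀ b, T (e b) = c • e b := by
    intro b
    by_cases hb : Function.Injective b
    · obtain ⟨σ, rfl⟩ := exists_perm_comp_eq ha hb
      rw [← he, hT, h2, map_smul]
    · have : e b = 0 := Subtype.ext (hookVec_eq_zero hb)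
      rw [this, map_zero, smul_zero]
  refine ⟨c, ?_⟩
  rintro ⟨v, hv⟩
  induction hv using Submodule.span_induction with
  | mem v hv => obtain ⟨b, rfl⟩ := hv; exact h3 b
  | zero => exact (map_zero T).trans (smul_zero c).symm
  | add v w hv hw ihv ihw =>
    have : (⟨v + w, add_mem hv hw⟩ : hookSpace) = ⟨v, hv⟩ + ⟨w, hw⟩ := rfl
    rw [this, map_add, smul_add]; exact congrArg₂ _ ihv ihw
  | smul r v hv ih =>
    have : (⟨r • v, Submodule.smul_mem _ r hv⟩ : hookSpace) = r • ⟨v, hv⟩ := rfl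
    rw [this, map_smul, smul_comm c]; exact congrArg _ ih

theorem hookRep_eq_one {σ : Perm (Fin 8)} (h : hookRep σ = 1) : σ = 1 := by
  by_contra hσ
  obtain ⟨p, hp⟩ : ∃ p, σ p ≠ p := by
    by_contra! hc; exact hσ (Equiv.ext hc)
  obtain ⟨τ, hτ⟩ := exists_perm_comp_eq (a := ![(0 : Fin 8), 1]) (b := ![p, σ p])
    (by decide) (by intro i j; fin_cases i <;> fin_cases j <;> simp [hp, hp.symm])
  have h0 : τ 0 = p := congrFun hτ 0
  have h1 : τ 1 = σ p := congrFun hτ 1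
  -- The column contains `σ p` but not `p`, so its image under `σ` misses `σ p`. The coefficient at
  -- `a ∘ Fin.succ`, whose first entry is `σ p`, then drops from `1` to `0`.
  let a : Fin 5 → Fin 8 := τ ∘ ![2, 1, 3, 4, 5]
  have ha : Function.Injective a := τ.injective.comp (by decide)
  have h2 : fourRep σ (hookVec a) = hookVec a :=
    congrArg Subtype.val (LinearMap.congr_fun h ⟨hookVec a, hookVec_mem a⟩)
  have h3 := congrArg (fun f : FourFun => f (a ∘ Fin.succ)) h2
  simp only [fourRep_hookVec, hookVec_apply, hookDet_comp_succ ha] at h3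
  rw [hookDet_eq_zero_of_not_mem 0] at h3
  · simp at h3
  · intro s hs
    have h4 : (σ p : Fin 8) = σ (a s) := by
      rw [← h1]; exact hs
    have h5 : τ 0 = τ (![2, 1, 3, 4, 5] s) := by rw [h0]; exact σ.injective h4
    have h6 := τ.injective h5
    fin_cases s <;> simp at h6

theorem hookRep_injective : Function.Injective hookRep := by
  intro σ τ h
  rw [← inv_mul_eq_one]
  refine hookRep_eq_one ?_
  rw [map_mul, ← h, ← map_mul, inv_mul_cancel, map_one]

/-- An odd permutation has both eigenvalues `1` and `-1` on `hookSpace`. -/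
theorem exists_hookRep_eigenvector {σ : Perm (Fin 8)} (hσ : sign σ = -1) {ε : ℝ}
    (hε : ε = 1 ∨ ε = -1) : ∃ v : hookSpace, v ≠ 0 ∧ hookRep σ v = ε • v := by
  obtain ⟨r, hr, hc⟩ := exists_mem_permEightReps_isConj σ
  obtain ⟨τ, rfl⟩ := isConj_iff.1 hc
  have hsr : sign r = -1 := by
    rwa [map_mul, map_mul, map_inv, mul_right_comm, mul_inv_cancel, one_mul] at hσ
  obtain ⟨N, hN, hrN, hs1, hs2⟩ := hasNonzeroOrbitSums_of_sign hr hsr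
  have hNe : Even N := by
    simp only [List.mem_cons, List.not_mem_nil, or_false] at hN
    rcases hN with rfl | rfl | rfl | rfl | rfl | rfl <;> decide
  have hεε : ε * ε = 1 := by rcases hε with rfl | rfl <;> norm_num
  have hεN : ε ^ N = 1 := by rcases hε with rfl | rfl <;> simp [hNe.neg_one_pow]
  let e : hookSpace := ⟨hookVec ![0, 2, 3, 4, 7], hookVec_mem _⟩
  -- The sum weighted by powers of `ε` over the cyclic group of `r` is an `ε`-eigenvector, since `ε
  -- ^ N = 1` and `r ^ N = 1`. One of its coefficients is the orbit sum checked to be nonzero.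
  let v : hookSpace := ∑ j ∈ Finset.range N, ε ^ j • hookRep (r ^ j) e
  have hv : hookRep r v = ε • v := by
    have h1 : hookRep r v = ε • ∑ j ∈ Finset.range N, ε ^ (j + 1) • hookRep (r ^ (j + 1)) e := by
      simp only [v, map_sum, map_smul, Finset.smul_sum]
      refine Finset.sum_congr rfl fun j _ => ?_
      rw [smul_smul, pow_succ' ε, ← mul_assoc, hεε, one_mul, pow_succ' r, map_mul]; rfl
    have h2 := Finset.sum_range_succ' (fun j => ε ^ j • hookRep (r ^ j) e) N
    rw [Finset.sum_range_succ, hεN, hrN, pow_zero, pow_zero, add_left_inj] at h2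
    rw [h1, ← h2]
  have hv0 : v ≠ 0 := by
    intro h
    have h1 : (v : FourFun) ![0, 2, 3, 4] = 0 := by rw [h]; rfl
    have h2 : (v : FourFun) ![0, 2, 3, 4] = ∑ j ∈ Finset.range N, ε ^ j *
        (hookDet ((r ^ j : Perm (Fin 8)) ∘ ![0, 2, 3, 4, 7]) ![0, 2, 3, 4] : ℝ) := by
      simp only [v, Submodule.coe_sum, Submodule.coe_smul, WithLp.ofLp_sum, Finset.sum_apply]
      refine Finset.sum_congr rfl fun j _ => ?_
      rw [coe_hookRep, fourRep_hookVec]; rfl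
    rw [h2] at h1
    rcases hε with rfl | rfl
    · simp only [one_pow, one_mul] at h1; exact hs1 (by exact_mod_cast h1)
    · exact hs2 (by exact_mod_cast h1)
  have hinj : ∀ w, hookRep τ w = 0 → w = 0 := fun w hw => by
    have : hookRep τ⁻¹ (hookRep τ w) = w := by
      rw [← Module.End.mul_apply, ← map_mul, inv_mul_cancel, map_one]; rfl
    rw [← this, hw, map_zero]
  refine ⟨hookRep τ v, fun h => hv0 (hinj v h), ?_⟩
  rw [← map_smul, ← hv, ← Module.End.mul_apply, ← map_mul, inv_mul_cancel_right, map_mul]; rfl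

theorem inner_hookRep (σ : Perm (Fin 8)) (v w : hookSpace) :
    inner ℝ (hookRep σ v) (hookRep σ w) = inner ℝ v w :=
  inner_fourRep σ v w

/-- A transposition is diagonal in an orthonormal basis of `hookSpace`, and has determinant `1`. -/
theorem exists_orthonormalBasis_swap {a b : Fin 8} (hab : a ≠ b) :
    ∃ (B : OrthonormalBasis (Fin 35) ℝ hookSpace) (s : Fin 35 → ℝ), ∏ i, s i = 1 ∧
      ∀ i, hookRep (swap a b) (B i) = s i • B i := by
  have hinv : ∀ v, hookRep (swap a b) (hookRep (swap a b) v) = v := fun v => by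
    rw [← Module.End.mul_apply, ← map_mul, swap_mul_self, map_one]; rfl
  have hsymm : (hookRep (swap a b)).IsSymmetric := fun v w => by
    rw [← inner_hookRep (swap a b), hinv]
  let B := hsymm.eigenvectorBasis finrank_hookSpace
  let s := hsymm.eigenvalues finrank_hookSpace
  have hB : ∀ i, hookRep (swap a b) (B i) = s i • B i := fun i =>
    hsymm.apply_eigenvectorBasis finrank_hookSpace i
  have hs : ∀ i, s i = 1 ∨ s i = -1 := fun i => by
    have h := hinv (B i)
    rw [hB, map_smul, hB, smul_smul] at h
    have h2 : (s i * s i - 1) • B i = 0 := by rw [sub_smul, h, one_smul, sub_self]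
    rcases smul_eq_zero.1 h2 with h3 | h3
    · exact mul_self_eq_one_iff.1 (sub_eq_zero.1 h3)
    · exact absurd h3 (B.orthonormal.ne_zero i)
  have htr : ∑ i, s i = -5 := by
    rw [← trace_hookRep_swap hab, LinearMap.trace_eq_sum_inner _ B]
    refine Finset.sum_congr rfl fun i _ => ?_
    rw [hB]
    refine Eq.trans ?_ (real_inner_smul_right (B i) (B i) (s i)).symm
    rw [real_inner_self_eq_norm_sq, B.orthonormal.1 i]; simp
  refine ⟨B, s, ?_, hB⟩
  let P : Finset (Fin 35) := Finset.univ.filter fun i => s i = -1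
  have h1 : ∀ i, s i = if i ∈ P then -1 else 1 := fun i => by
    rcases hs i with h | h
    · rw [if_neg, h]; simp [P, h]; norm_num
    · rw [if_pos, h]; simp [P, h]
  have h2 : ∑ i, s i = 35 - 2 * (P.card : ℝ) := by
    have : ∀ i, s i = 1 - 2 * (if i ∈ P then 1 else 0 : ℝ) := fun i => by
      rw [h1]; split_ifs <;> norm_num
    simp only [this, Finset.sum_sub_distrib, ← Finset.mul_sum]
    simp
  -- The trace gives `35 - 2 |P| = -5`; the determinant is `1` because `20` is even.
  have h3 : P.card = 20 := by
    have : (P.card : ℝ) = 20 := by linarith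
    exact_mod_cast this
  simp only [h1]
  rw [Finset.prod_ite]
  simp [h3, Even.neg_one_pow (show Even 20 by decide)]

/-! ### Identification with the Specht module -/

theorem hookDiagram_cells : hookDiagram.cells =
    {(0, 0), (0, 1), (0, 2), (0, 3), (1, 0), (2, 0), (3, 0), (4, 0)} := by
  decide +kernel

theorem mem_hookDiagram_cells {c : ℕ × ℕ} (hc : c ∈ hookDiagram.cells) :
    c.1 ≤ 4 ∧ (c.1 ≠ 0 → c.2 = 0) ∧ (c.2 ≠ 0 → c.1 = 0) := by
  rw [hookDiagram_cells] at hc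
  simp only [Finset.mem_insert, Finset.mem_singleton] at hc
  rcases hc with rfl | rfl | rfl | rfl | rfl | rfl | rfl | rfl <;> simp

/-- The `s`-th cell of the first column. -/
def columnCell (s : Fin 5) : hookDiagram.cells :=
  ⟨((s : ℕ), 0), by rw [hookDiagram_cells]; fin_cases s <;> simp⟩

theorem columnCell_injective : Function.Injective columnCell := fun s s' h => by
  simpa [columnCell, Fin.ext_iff] using h

theorem exists_columnCell {c : hookDiagram.cells} (hc : c.1.2 = 0) : ∃ s, columnCell s = c :=
  ⟨⟨c.1.1, Nat.lt_succ_of_le (mem_hookDiagram_cells c.2).1⟩, Subtype.ext (Prod.ext rfl hc.symm)⟩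

/-- The entries of the first column. -/
def YoungTableau.firstColumn (t : YoungTableau hookDiagram (Fin 8)) : Fin 5 → Fin 8 :=
  fun s => t.symm (columnCell s)

theorem YoungTableau.firstColumn_injective (t : YoungTableau hookDiagram (Fin 8)) :
    Function.Injective t.firstColumn := t.symm.injective.comp columnCell_injective

theorem YoungTableau.row_eq_succ_iff (t : YoungTableau hookDiagram (Fin 8)) (a : Fin 8)
    (r : Fin 4) : t.row a = (r : ℕ) + 1 ↔ a = t.firstColumn r.succ := by
  rw [YoungTableau.firstColumn, Equiv.eq_symm_apply, YoungTableau.row]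
  constructor
  · intro h
    have h2 := (mem_hookDiagram_cells (t a).2).2.1 (by omega)
    exact Subtype.ext (Prod.ext h h2)
  · intro h
    rw [h]; rfl

/-- The indicator function of the sequences of entries in the rows `1, …, 4` of a tabloid. -/
def tabloidVec (T : YoungTabloid hookDiagram (Fin 8)) : FourFun :=
  WithLp.toLp 2 fun y => if ∀ r : Fin 4, T.1 (y r) = (r : ℕ) + 1 then 1 else 0

theorem tabloidVec_apply (T : YoungTabloid hookDiagram (Fin 8)) (y : Fin 4 → Fin 8) :
    tabloidVec T y = if ∀ r : Fin 4, T.1 (y r) = (r : ℕ) + 1 then 1 else 0 := rfl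

theorem tabloidVec_tabloid (t : YoungTableau hookDiagram (Fin 8)) (y : Fin 4 → Fin 8) :
    tabloidVec t.tabloid y = if y = t.firstColumn ∘ Fin.succ then 1 else 0 := by
  rw [tabloidVec_apply]
  congr 1
  rw [funext_iff, eq_iff_iff]
  exact forall_congr' fun r => t.row_eq_succ_iff _ r

theorem tabloid_eq_of_firstColumn {t t' : YoungTableau hookDiagram (Fin 8)}
    (h : t.firstColumn ∘ Fin.succ = t'.firstColumn ∘ Fin.succ) : t.tabloid = t'.tabloid := by
  refine Subtype.ext (funext fun a => ?_)
  change t.row a = t'.row a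
  have key : ∀ r : Fin 4, t.row a = (r : ℕ) + 1 ↔ t'.row a = (r : ℕ) + 1 := fun r => by
    rw [t.row_eq_succ_iff, t'.row_eq_succ_iff]
    have := congrFun h r
    simp only [Function.comp_apply] at this
    rw [this]
  have h1 : t.row a ≤ 4 := (mem_hookDiagram_cells (t a).2).1
  have h2 : t'.row a ≤ 4 := (mem_hookDiagram_cells (t' a).2).1
  have k0 := key 0
  have k1 := key 1
  have k2 := key 2
  have k3 := key 3
  simp at k0 k1 k2 k3
  omega

/-- The linear map from the permutation module on tabloids to functions of four indices. -/
def tabloidMap : MonoidAlgebra ℝ (YoungTabloid hookDiagram (Fin 8)) →ₗ[ℝ] FourFun :=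
  Finsupp.linearCombination ℝ tabloidVec ∘ₗ (MonoidAlgebra.coeffLinearEquiv ℝ).toLinearMap

theorem tabloidMap_single (T : YoungTabloid hookDiagram (Fin 8)) (c : ℝ) :
    tabloidMap (MonoidAlgebra.single T c) = c • tabloidVec T := by
  change Finsupp.linearCombination ℝ tabloidVec (Finsupp.single T c) = _
  rw [Finsupp.linearCombination_single]

/-- A tabloid of hook shape is determined by its entries in the rows `1, …, 4`, so distinct tabloids
go to indicator functions of distinct points. -/
theorem tabloidMap_injective : Function.Injective tabloidMap := by
  suffices h : LinearIndependent ℝ tabloidVec from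
    Function.Injective.comp (g := Finsupp.linearCombination ℝ tabloidVec)
      (f := MonoidAlgebra.coeffLinearEquiv ℝ) h (LinearEquiv.injective _)
  rw [linearIndependent_iff']
  intro S c hS T hT
  obtain ⟨t, ht⟩ := T.2
  have hTt : T = t.tabloid := Subtype.ext ht.symm
  have h := congrArg (fun f : FourFun => f (t.firstColumn ∘ Fin.succ)) hS
  simp only [WithLp.ofLp_sum, WithLp.ofLp_smul, Finset.sum_apply, Pi.smul_apply, smul_eq_mul,
    WithLp.ofLp_zero, Pi.zero_apply] at h
  rw [Finset.sum_eq_single T] at h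
  · rw [hTt, tabloidVec_tabloid, if_pos rfl, mul_one] at h
    rw [hTt]; exact h
  · intro T' _ hne
    obtain ⟨t', ht'⟩ := T'.2
    have hTt' : T' = t'.tabloid := Subtype.ext ht'.symm
    rw [hTt', tabloidVec_tabloid, if_neg, mul_zero]
    intro he
    exact hne (by rw [hTt, hTt', tabloid_eq_of_firstColumn he])
  · intro h; exact absurd hT h

theorem tabloidMap_equivariant (σ : Perm (Fin 8))
    (v : MonoidAlgebra ℝ (YoungTabloid hookDiagram (Fin 8))) :
    tabloidMap (tabloidRepresentation hookDiagram (Fin 8) σ v) = fourRep σ (tabloidMap v) := by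
  have h : tabloidMap ∘ₗ tabloidRepresentation hookDiagram (Fin 8) σ =
      fourRep σ ∘ₗ tabloidMap := by
    refine MonoidAlgebra.lhom_ext' fun T => LinearMap.ext fun c => ?_
    change tabloidMap (tabloidRepresentation hookDiagram (Fin 8) σ (MonoidAlgebra.single T c)) =
      fourRep σ (tabloidMap (MonoidAlgebra.single T c))
    rw [Representation.ofMulAction_single,
      tabloidMap_single, tabloidMap_single, map_smul]
    rfl
  exact LinearMap.congr_fun h v

theorem hookDet_eq_sum (a : Fin 5 → Fin 8) (y : Fin 4 → Fin 8) :
    hookDet a y = ∑ π : Perm (Fin 5), (sign π : ℤ) * if y = a ∘ π ∘ Fin.succ then 1 else 0 := by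
  rw [hookDet, ← Matrix.det_transpose, Matrix.det_apply']
  refine Finset.sum_congr rfl fun π _ => ?_
  rw [Int.cast_id, Fin.prod_univ_succ]
  simp only [Matrix.transpose_apply, Matrix.of_apply, Fin.cons_zero, Fin.cons_succ, one_mul,
    Fintype.prod_boole, funext_iff, Function.comp_apply]
  split_ifs <;> rfl

/-- Permutations of the entries of the first column, extended by the identity. -/
def YoungTableau.columnPerm (t : YoungTableau hookDiagram (Fin 8)) (π : Perm (Fin 5)) :
    Perm (Fin 8) :=
  π.viaFintypeEmbedding ⟨t.firstColumn, t.firstColumn_injective⟩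

theorem YoungTableau.columnPerm_firstColumn (t : YoungTableau hookDiagram (Fin 8))
    (π : Perm (Fin 5)) (s : Fin 5) :
    t.columnPerm π (t.firstColumn s) = t.firstColumn (π s) :=
  viaFintypeEmbedding_apply_image _ ⟨t.firstColumn, t.firstColumn_injective⟩ s

theorem YoungTableau.columnPerm_of_ne (t : YoungTableau hookDiagram (Fin 8))
    (π : Perm (Fin 5)) {a : Fin 8} (ha : (t a).1.2 ≠ 0) : t.columnPerm π a = a := by
  refine viaFintypeEmbedding_apply_notMem_range _ _ ?_
  rintro ⟨s, rfl⟩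
  apply ha
  change (t (t.symm (columnCell s))).1.2 = 0
  rw [Equiv.apply_symm_apply]; rfl

theorem YoungTableau.exists_firstColumn (t : YoungTableau hookDiagram (Fin 8)) {a : Fin 8}
    (ha : (t a).1.2 = 0) : ∃ s, t.firstColumn s = a := by
  obtain ⟨s, hs⟩ := exists_columnCell ha
  exact ⟨s, by rw [firstColumn, hs, Equiv.symm_apply_apply]⟩

theorem YoungTableau.col_firstColumn (t : YoungTableau hookDiagram (Fin 8)) (s : Fin 5) :
    (t (t.firstColumn s)).1.2 = 0 := by
  rw [firstColumn, Equiv.apply_symm_apply]; rfl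

/-- Apart from the first, each column has a single cell, so the column stabilizer is the symmetric
group of the first column. The defining sum is then the Leibniz expansion of the determinant, whose
row of ones leaves row `0` unconstrained. -/
theorem tabloidMap_polytabloid (t : YoungTableau hookDiagram (Fin 8)) :
    tabloidMap t.polytabloid = hookVec t.firstColumn := by
  have hbij : ∑ σ ∈ t.columnGroup, ((sign σ : ℤ) : ℝ) • tabloidVec (σ • t.tabloid) =
      ∑ π : Perm (Fin 5), ((sign π : ℤ) : ℝ) • tabloidVec (t.columnPerm π • t.tabloid) := by
    symm
    refine Finset.sum_bij (fun π _ => t.columnPerm π) ?_ ?_ ?_ ?_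
    · intro π _
      simp only [YoungTableau.columnGroup, Finset.mem_filter, Finset.mem_univ, true_and]
      intro a
      by_cases ha : (t a).1.2 = 0
      · obtain ⟨s, rfl⟩ := t.exists_firstColumn ha
        rw [t.columnPerm_firstColumn, t.col_firstColumn, t.col_firstColumn]
      · rw [t.columnPerm_of_ne π ha]
    · intro π _ π' _ h
      refine Equiv.ext fun s => t.firstColumn_injective ?_
      rw [← t.columnPerm_firstColumn, ← t.columnPerm_firstColumn, h]
    · intro σ hσ
      simp only [YoungTableau.columnGroup, Finset.mem_filter, Finset.mem_univ, true_and] at hσ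
      choose f hf using fun s => t.exists_firstColumn
        ((hσ (t.firstColumn s)).trans (t.col_firstColumn s))
      have hfinj : Function.Injective f := fun s s' h =>
        t.firstColumn_injective (σ.injective (by rw [← hf, ← hf, h]))
      refine ⟨Equiv.ofBijective f (Finite.injective_iff_bijective.1 hfinj), Finset.mem_univ _, ?_⟩
      ext1 a
      by_cases ha : (t a).1.2 = 0
      · obtain ⟨s, rfl⟩ := t.exists_firstColumn ha
        rw [t.columnPerm_firstColumn]; exact hf s
      · rw [t.columnPerm_of_ne _ ha]
        refine t.injective (Subtype.ext (Prod.ext ?_ (hσ a).symm))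
        rw [(mem_hookDiagram_cells (t a).2).2.2 ha,
          (mem_hookDiagram_cells (t (σ a)).2).2.2 (by rwa [hσ a])]
    · intro π _
      rw [YoungTableau.columnPerm, viaFintypeEmbedding_sign]
  rw [YoungTableau.polytabloid, map_sum]
  simp only [tabloidMap_single]
  rw [hbij]
  ext y
  rw [hookVec_apply, hookDet_eq_sum]
  simp only [WithLp.ofLp_sum, WithLp.ofLp_smul, Finset.sum_apply, Pi.smul_apply, smul_eq_mul,
    Int.cast_sum, Int.cast_mul]
  refine Finset.sum_congr rfl fun π _ => ?_
  rw [YoungTableau.smul_tabloid, tabloidVec_tabloid]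
  have h : (t.perm (t.columnPerm π)).firstColumn ∘ Fin.succ = t.firstColumn ∘ π ∘ Fin.succ := by
    ext r
    exact congrArg Fin.val (t.columnPerm_firstColumn π r.succ)
  rw [h]
  split_ifs <;> simp

theorem map_tabloidMap_specht :
    (spechtSubrepresentation hookDiagram (Fin 8)).toSubmodule.map tabloidMap = hookSpace := by
  change (Submodule.span ℝ _).map tabloidMap = Submodule.span ℝ _
  rw [Submodule.map_span]
  refine le_antisymm (Submodule.span_mono ?_) (Submodule.span_le.2 ?_)
  · rintro _ ⟨_, ⟨t, rfl⟩, rfl⟩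
    exact ⟨_, (tabloidMap_polytabloid t).symm⟩
  · rintro _ ⟨a, rfl⟩
    by_cases ha : Function.Injective a
    · have hcard : Fintype.card (Fin 8) = Fintype.card hookDiagram.cells := by
        rw [Fintype.card_coe, hookDiagram_cells]; decide
      let t : YoungTableau hookDiagram (Fin 8) := Fintype.equivOfCardEq hcard
      obtain ⟨σ, hσ⟩ := exists_perm_comp_eq t.firstColumn_injective ha
      refine Submodule.subset_span ⟨_, ⟨t.perm σ, rfl⟩, ?_⟩
      rw [tabloidMap_polytabloid, ← hσ]; rfl
    · rw [hookVec_eq_zero ha]; exact zero_mem _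

/-- The Specht module of the partition `(4, 1, 1, 1, 1)` is isomorphic to `hookSpace`. -/
def spechtEquiv : (spechtSubrepresentation hookDiagram (Fin 8)).toSubmodule ≃ₗ[ℝ] hookSpace :=
  (Submodule.equivMapOfInjective tabloidMap tabloidMap_injective _).trans
    (LinearEquiv.ofEq _ _ map_tabloidMap_specht)

theorem spechtEquiv_equivariant (σ : Perm (Fin 8))
    (v : (spechtSubrepresentation hookDiagram (Fin 8)).toSubmodule) :
    spechtEquiv (spechtRepresentation hookDiagram (Fin 8) σ v) = hookRep σ (spechtEquiv v) :=
  Subtype.ext (tabloidMap_equivariant σ v)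

/-! ### Orthogonal matrices for the representation and its lift -/

/-- `hookRep` in coordinates with respect to an orthonormal basis. -/
def hookMatrixRep (B : OrthonormalBasis (Fin 35) ℝ hookSpace) :
    Representation ℝ (Perm (Fin 8)) (Fin 35 → ℝ) where
  toFun σ := B.toBasis.equivFun.conj (hookRep σ)
  map_one' := by
    rw [map_one]
    exact LinearEquiv.conj_id _
  map_mul' σ τ := by
    rw [map_mul]
    exact LinearEquiv.conj_comp _ _ _

theorem hookMatrixRep_apply (B : OrthonormalBasis (Fin 35) ℝ hookSpace) (σ : Perm (Fin 8))
    (v : hookSpace) :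
    hookMatrixRep B σ (B.toBasis.equivFun v) = B.toBasis.equivFun (hookRep σ v) := by
  change B.toBasis.equivFun.conj (hookRep σ) _ = _
  rw [LinearEquiv.conj_apply_apply, LinearEquiv.symm_apply_apply]

theorem equivFun_dotProduct (B : OrthonormalBasis (Fin 35) ℝ hookSpace) (v w : hookSpace) :
    B.toBasis.equivFun v ⬝ᵥ B.toBasis.equivFun w = inner ℝ v w := by
  rw [← B.sum_inner_mul_inner v w]
  refine Finset.sum_congr rfl fun i _ => ?_
  simp only [Module.Basis.equivFun_apply, OrthonormalBasis.coe_toBasis_repr_apply,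
    OrthonormalBasis.repr_apply_apply]
  rw [real_inner_comm v]

theorem hookMatrixRep_dotProduct (B : OrthonormalBasis (Fin 35) ℝ hookSpace) (σ : Perm (Fin 8))
    (v w : Fin 35 → ℝ) : hookMatrixRep B σ v ⬝ᵥ hookMatrixRep B σ w = v ⬝ᵥ w := by
  obtain ⟨v, rfl⟩ := B.toBasis.equivFun.surjective v
  obtain ⟨w, rfl⟩ := B.toBasis.equivFun.surjective w
  rw [hookMatrixRep_apply, hookMatrixRep_apply, equivFun_dotProduct, equivFun_dotProduct,
    inner_hookRep]

theorem trace_hookMatrixRep (B : OrthonormalBasis (Fin 35) ℝ hookSpace) (σ : Perm (Fin 8)) :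
    LinearMap.trace ℝ _ (hookMatrixRep B σ) = LinearMap.trace ℝ _ (hookRep σ) :=
  LinearMap.trace_conj' _ _

theorem hookMatrixRep_commutant (B : OrthonormalBasis (Fin 35) ℝ hookSpace)
    (T : (Fin 35 → ℝ) →ₗ[ℝ] (Fin 35 → ℝ))
    (hT : ∀ σ v, T (hookMatrixRep B σ v) = hookMatrixRep B σ (T v)) :
    ∃ c : ℝ, ∀ v, T v = c • v := by
  let e := B.toBasis.equivFun
  obtain ⟨c, hc⟩ := hookRep_commutant (T := e.symm.conj T) fun σ v => by
    apply e.injective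
    rw [LinearEquiv.conj_apply_apply, LinearEquiv.apply_symm_apply, LinearEquiv.symm_symm,
      ← hookMatrixRep_apply, hT, ← hookMatrixRep_apply, LinearEquiv.conj_apply_apply,
      LinearEquiv.symm_symm, LinearEquiv.apply_symm_apply]
  refine ⟨c, fun v => ?_⟩
  obtain ⟨v, rfl⟩ := e.surjective v
  have h := hc v
  rw [LinearEquiv.conj_apply_apply, LinearEquiv.symm_symm, LinearEquiv.symm_apply_eq, map_smul] at h
  exact h

/-- The trace on `V ⊗ ℝᵏ` is `-5 k` in dimension `35 k`, so the `-1`-eigenspace has dimension `(35 k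
+ 5 k) / 2`. -/
theorem finrank_ker_tensRep_add_one (B : OrthonormalBasis (Fin 35) ℝ hookSpace) (k : ℕ)
    {σ : Perm (Fin 8)} (hσ : σ * σ = 1) (htr : LinearMap.trace ℝ _ (hookRep σ) = -5) :
    Module.finrank ℝ (LinearMap.ker (tensRep k (hookMatrixRep B) σ + 1)) = 20 * k := by
  have h := trace_of_involution (A := tensRep k (hookMatrixRep B) σ) fun v => by
    rw [← Module.End.mul_apply, ← map_mul, hσ, map_one]; rfl
  rw [tensRep_apply, trace_tensEnd, trace_hookMatrixRep, htr, Module.finrank_fin_fun] at h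
  push_cast at h
  have h2 : (Module.finrank ℝ (LinearMap.ker (tensRep k (hookMatrixRep B) σ + 1)) : ℝ) =
      20 * k := by
    rw [tensRep_apply]; linarith
  exact_mod_cast h2

theorem exists_spin_lift_tensRep (B : OrthonormalBasis (Fin 35) ℝ hookSpace) {k : ℕ} (hk : 0 < k) :
    ∃ φ : Perm (Fin 8) →* Spin (35 * k),
      ∀ σ, spinCover _ (φ σ) = tensRep k (hookMatrixRep B) σ := by
  have hs := isCoxeterFamily_adjacentSwap 7
  refine exists_spin_lift_of_representation (n := 7) (by omega) _
    (fun σ => tensEnd_dotProduct (hookMatrixRep_dotProduct B σ)) (fun i hi => ?_)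
    fun i j hij hj => ?_
  · rw [finrank_ker_tensRep_add_one B k (hs.sq i hi)]
    · exact ⟨5 * k, by ring⟩
    · rw [adjacentSwap_of_lt hi]
      exact trace_hookRep_swap (by simp)
  · have hi : i < 7 := by omega
    have hcomm := hs.comm i j hij hj
    rw [finrank_ker_tensRep_add_one B k]
    · exact ⟨5 * k, by ring⟩
    · rw [mul_assoc, ← mul_assoc (adjacentSwap 7 j), ← hcomm, mul_assoc (adjacentSwap 7 i),
        hs.sq j hj, mul_one, hs.sq i hi]
    · rw [adjacentSwap_of_lt hi, adjacentSwap_of_lt hj]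
      refine trace_hookRep_swap_mul_swap (by simp) (by simp) (disjoint_swap_swap ?_)
      simp [Fin.ext_iff]; omega

theorem hookMatrixRep_injective (B : OrthonormalBasis (Fin 35) ℝ hookSpace) :
    Function.Injective (hookMatrixRep B) :=
  B.toBasis.equivFun.conj.injective.comp hookRep_injective

theorem tensEnd_injective {d k : ℕ} (hk : 0 < k) : Function.Injective (tensEnd (d := d) k) := by
  intro A A' h
  refine LinearMap.ext fun v => funext fun i => ?_
  have h2 := congrFun (LinearMap.congr_fun h (tens v (Pi.single ⟨0, hk⟩ 1)))
    (finProdFinEquiv (i, ⟨0, hk⟩))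
  simpa [tensEnd_tens, tens_apply] using h2

theorem tens_ne_zero {d k : ℕ} {v : Fin d → ℝ} (hv : v ≠ 0) {u : Fin k → ℝ} (hu : u ≠ 0) :
    tens v u ≠ 0 := by
  obtain ⟨i, hi⟩ := Function.ne_iff.1 hv
  obtain ⟨j, hj⟩ := Function.ne_iff.1 hu
  intro h
  have := congrFun h (finProdFinEquiv (i, j))
  rw [tens_apply] at this
  exact mul_ne_zero hi hj this

/-! ### The sign twist, non-conjugacy and the conclusion -/

/-- Twisting a homomorphism from a symmetric group by the sign with values in `{1, z}`. -/
def signTwist {G : Type*} [Group G] {n : ℕ} {z : G} (hz : z * z = 1) (hc : ∀ x, z * x = x * z)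
    (φ : Perm (Fin n) →* G) : Perm (Fin n) →* G where
  toFun σ := (if sign σ = 1 then 1 else z) * φ σ
  map_one' := by simp
  map_mul' σ τ := by
    rw [map_mul, map_mul]
    rcases Int.units_eq_one_or (sign σ) with h1 | h1 <;>
      rcases Int.units_eq_one_or (sign τ) with h2 | h2 <;>
      simp only [h1, h2, one_mul, mul_one, if_true, if_neg (show (-1 : ℤˣ) ≠ 1 by decide),
        mul_assoc, neg_mul_neg]
    · rw [← mul_assoc, hc, mul_assoc]
    · rw [← mul_assoc (φ σ), ← hc, ← mul_assoc, ← mul_assoc, hz, one_mul]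

theorem signTwist_of_sign_eq_one {G : Type*} [Group G] {n : ℕ} {z : G} (hz : z * z = 1)
    (hc : ∀ x, z * x = x * z) (φ : Perm (Fin n) →* G) {σ : Perm (Fin n)} (h : sign σ = 1) :
    signTwist hz hc φ σ = φ σ := by
  change (if sign σ = 1 then 1 else z) * φ σ = _
  rw [if_pos h, one_mul]

theorem signTwist_of_sign_eq_neg_one {G : Type*} [Group G] {n : ℕ} {z : G} (hz : z * z = 1)
    (hc : ∀ x, z * x = x * z) (φ : Perm (Fin n) →* G) {σ : Perm (Fin n)} (h : sign σ = -1) :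
    signTwist hz hc φ σ = z * φ σ := by
  change (if sign σ = 1 then 1 else z) * φ σ = _
  rw [h, if_neg (by decide)]

theorem almostConjugate_range {G H : Type*} [Group G] [Group H] {φ ψ : H →* G}
    (hφ : Function.Injective φ) (hψ : Function.Injective ψ) (h : ∀ x, IsConj (φ x) (ψ x)) :
    AlmostConjugate φ.range ψ.range := by
  refine ⟨((MonoidHom.ofInjective hφ).symm.trans (MonoidHom.ofInjective hψ)).toEquiv, fun γ => ?_⟩
  obtain ⟨x, rfl⟩ := (MonoidHom.ofInjective hφ).surjective γ
  obtain ⟨c, hc⟩ := isConj_iff.1 (h x)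
  refine isConj_iff.2 ⟨c, ?_⟩
  rw [MulEquiv.toEquiv_eq_coe, MulEquiv.coe_toEquiv, MulEquiv.trans_apply,
    MulEquiv.symm_apply_apply]
  exact hc

/-- If the images of two faithful representations of a finite group are conjugate, then the
representations are equivalent up to an automorphism. -/
theorem exists_mulEquiv_of_conjugateSubgroups {G H : Type*} [Group G] [Group H] [Finite H]
    {φ ψ : H →* G} (hφ : Function.Injective φ) (hψ : Function.Injective ψ)
    (h : ConjugateSubgroups φ.range ψ.range) :
    ∃ (g : G) (α : H ≃* H), ∀ x, g * φ x * g⁻¹ = ψ (α x) := by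
  obtain ⟨g, hg⟩ := h
  have hex : ∀ x, ∃ y, ψ y = g * φ x * g⁻¹ := fun x => by
    have : g * φ x * g⁻¹ ∈ ψ.range := hg ▸ ⟨φ x, ⟨x, rfl⟩, rfl⟩
    exact this
  choose f hf using hex
  let α : H →* H := MonoidHom.mk' f fun x y => hψ (by
    rw [map_mul, hf, hf, hf, map_mul]; group)
  have hα : Function.Injective α := fun x y hxy => hφ (by
    have h : ψ (f x) = ψ (f y) := congrArg ψ hxy
    rw [hf, hf] at h
    exact mul_left_cancel (mul_right_cancel h))
  exact ⟨g, MulEquiv.ofBijective α (Finite.injective_iff_bijective.1 hα), fun x => (hf x).symm⟩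

/-- The isomorphism of `V ⊗ ℝᵏ` with `ℝ³⁵ᵏ` given by an orthonormal basis. -/
def hookTensorEquiv (B : OrthonormalBasis (Fin 35) ℝ hookSpace) (k : ℕ) :
    ((spechtSubrepresentation hookDiagram (Fin 8)).toSubmodule ⊗[ℝ] (Fin k → ℝ)) ≃ₗ[ℝ]
      (Fin (35 * k) → ℝ) :=
  (((B.toBasis.map spechtEquiv.symm).tensorProduct (Pi.basisFun ℝ (Fin k))).reindex
    finProdFinEquiv).equivFun

theorem hookTensorEquiv_tmul (B : OrthonormalBasis (Fin 35) ℝ hookSpace) (k : ℕ)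
    (v : (spechtSubrepresentation hookDiagram (Fin 8)).toSubmodule) (u : Fin k → ℝ) :
    hookTensorEquiv B k (v ⊗ₜ u) = tens (B.toBasis.equivFun (spechtEquiv v)) u := by
  refine funext_finProd fun i j => ?_
  rw [tens_apply]
  simp [hookTensorEquiv, mul_comm]

theorem hookTensorEquiv_equivariant (B : OrthonormalBasis (Fin 35) ℝ hookSpace) (k : ℕ)
    (σ : Perm (Fin 8)) :
    (hookTensorEquiv B k).toLinearMap ∘ₗ hookTensorTrivial k σ =
      tensRep k (hookMatrixRep B) σ ∘ₗ (hookTensorEquiv B k).toLinearMap := by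
  refine TensorProduct.ext' fun v u => ?_
  change hookTensorEquiv B k ((spechtRepresentation hookDiagram (Fin 8) σ v) ⊗ₜ u) =
    tensRep k (hookMatrixRep B) σ (hookTensorEquiv B k (v ⊗ₜ u))
  rw [hookTensorEquiv_tmul, hookTensorEquiv_tmul, spechtEquiv_equivariant, tensRep_apply,
    tensEnd_tens, hookMatrixRep_apply]

/-- A conjugating element can be corrected to intertwine `φ` with `ψ`. It then projects to some `1 ⊗
C` and must commute with `φ (swap 0 1)`, which forces the two lifts to agree there. -/
theorem not_conjugate_of_spin_lift {k : ℕ} (hk : 0 < k)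
    {B : OrthonormalBasis (Fin 35) ℝ hookSpace} {s : Fin 35 → ℝ} (hs : ∏ i, s i = 1)
    (hB : ∀ i, hookRep (swap 0 1) (B i) = s i • B i)
    {φ ψ : Perm (Fin 8) →* Spin (35 * k)}
    (hφ : ∀ σ, spinCover _ (φ σ) = tensRep k (hookMatrixRep B) σ)
    (hψ : ∀ σ, spinCover _ (ψ σ) = tensRep k (hookMatrixRep B) σ)
    (hφψ : φ (swap 0 1) ≠ ψ (swap 0 1)) : ¬ ConjugateSubgroups φ.range ψ.range := by
  intro hconj
  have hrho : Function.Injective (tensRep k (hookMatrixRep B)) :=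
    (tensEnd_injective hk).comp (hookMatrixRep_injective B)
  have hinj : ∀ χ : Perm (Fin 8) →* Spin (35 * k),
      (∀ σ, spinCover _ (χ σ) = tensRep k (hookMatrixRep B) σ) → Function.Injective χ :=
    fun χ hχ σ τ h => hrho (by rw [← hχ, ← hχ, h])
  obtain ⟨g, α, hg⟩ := exists_mulEquiv_of_conjugateSubgroups (hinj φ hφ) (hinj ψ hψ) hconj
  obtain ⟨τ, hτ⟩ := permEight_mulEquiv_inner α
  -- The induced automorphism is conjugation by `τ`, so dividing by `ψ τ` removes it.
  set g' := (ψ τ)⁻¹ * g with hg'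
  have hg2 : ∀ σ, g' * φ σ = ψ σ * g' := fun σ => by
    have h := hg σ
    rw [hτ, map_mul, map_mul, map_inv, mul_inv_eq_iff_eq_mul] at h
    rw [hg', mul_assoc, h]; group
  have hcomm : ∀ σ y, spinCover _ g' (tensRep k (hookMatrixRep B) σ y) =
      tensRep k (hookMatrixRep B) σ (spinCover _ g' y) := fun σ y => by
    rw [← Module.End.mul_apply, ← Module.End.mul_apply]
    congr 1
    conv_lhs => rw [← hφ σ]
    rw [← map_mul, hg2, map_mul, hψ]
  obtain ⟨C, hC⟩ := exists_isometry_of_commute_tensRep (by norm_num) (hookMatrixRep_commutant B)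
    hcomm (spinCover_dotProduct g')
  have hx : ∀ i u, spinCover _ (φ (swap 0 1)) (tens (Pi.single i 1) u) =
      s i • tens (Pi.single i 1) u := by
    intro i u
    have hi : (Pi.single i 1 : Fin 35 → ℝ) = B.toBasis.equivFun (B i) := by
      ext j
      simp [Pi.single_apply, eq_comm]
    rw [hφ, tensRep_apply, tensEnd_tens, hi, hookMatrixRep_apply, hB, map_smul, map_smul,
      LinearMap.smul_apply]
  have hgx := Spin.commute_of_tens hs hx C fun i u => hC _ u
  rw [hg2] at hgx
  exact hφψ (mul_right_cancel hgx).symm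

theorem mainTheorem5 (n : ℕ) (hn : 1 ≤ n) :
    ∃ Γ₁ Γ₂ : Subgroup (Spin (35 * (2 * n - 1))),
      Finite Γ₁ ∧ Finite Γ₂ ∧
      AlmostConjugate Γ₁ Γ₂ ∧ ¬ ConjugateSubgroups Γ₁ Γ₂ ∧
      ∃ φ₁ φ₂ : Equiv.Perm (Fin 8) →* Spin (35 * (2 * n - 1)),
        φ₁.range = Γ₁ ∧ φ₂.range = Γ₂ ∧
        (spinCover (35 * (2 * n - 1))).comp φ₁ = (spinCover (35 * (2 * n - 1))).comp φ₂ ∧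
        Nonempty (Representation.Equiv ((spinCover (35 * (2 * n - 1))).comp φ₁)
          (hookTensorTrivial (2 * n - 1))) := by
  have hk : 0 < 2 * n - 1 := by omega
  generalize 2 * n - 1 = k at hk ⊢
  obtain ⟨B, s, hs, hB⟩ := exists_orthonormalBasis_swap (show (0 : Fin 8) ≠ 1 by decide)
  obtain ⟨φ, hφ⟩ := exists_spin_lift_tensRep B hk
  obtain ⟨z, hz⟩ := Spin.exists_neg_one (m := 35 * k) (by omega)
  let ψ := signTwist (Spin.neg_one_mul_self hz) (Spin.neg_one_mul_comm hz) φ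
  have hψ : ∀ σ, spinCover _ (ψ σ) = tensRep k (hookMatrixRep B) σ := fun σ => by
    rcases Int.units_eq_one_or (sign σ) with h | h
    · rw [signTwist_of_sign_eq_one _ _ _ h, hφ]
    · rw [signTwist_of_sign_eq_neg_one _ _ _ h, map_mul, Spin.spinCover_neg_one hz, one_mul, hφ]
  have hrho : Function.Injective (tensRep k (hookMatrixRep B)) :=
    (tensEnd_injective hk).comp (hookMatrixRep_injective B)
  refine ⟨φ.range, ψ.range, Finite.of_surjective _ φ.rangeRestrict_surjective,
    Finite.of_surjective _ ψ.rangeRestrict_surjective, ?_, ?_, φ, ψ, rfl, rfl, ?_, ⟨?_⟩⟩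
  · refine almostConjugate_range (fun σ τ h => hrho (by rw [← hφ, ← hφ, h]))
      (fun σ τ h => hrho (by rw [← hψ, ← hψ, h])) fun σ => ?_
    rcases Int.units_eq_one_or (sign σ) with h | h
    · rw [signTwist_of_sign_eq_one _ _ _ h]
      exact IsConj.refl _
    -- For odd `σ` the two lifts are negatives of each other. Eigenvectors of `σ` on `V` for `-1`
    -- and `1`, tensored with a fixed nonzero vector of `ℝᵏ`, provide the vectors that conjugate
    -- them.
    · obtain ⟨u, hu, hσu⟩ := exists_hookRep_eigenvector h (Or.inr rfl)
      obtain ⟨v, hv, hσv⟩ := exists_hookRep_eigenvector h (Or.inl rfl)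
      have hone : (Pi.single ⟨0, hk⟩ 1 : Fin k → ℝ) ≠ 0 := by simp
      have hne : ∀ w : hookSpace, w ≠ 0 → B.toBasis.equivFun w ≠ 0 := fun w hw => by simpa using hw
      refine Spin.isConj_of_coe_eq_neg ?_ (tens_ne_zero (hne u hu) hone)
        (tens_ne_zero (hne v hv) hone) ?_ ?_
      · rw [signTwist_of_sign_eq_neg_one _ _ _ h, Submonoid.coe_mul, hz, neg_one_mul]
      · rw [hφ, tensRep_apply, tensEnd_tens, hookMatrixRep_apply, hσu, neg_one_smul, map_neg,
          map_neg, LinearMap.neg_apply]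
      · rw [hφ, tensRep_apply, tensEnd_tens, hookMatrixRep_apply, hσv, one_smul]
  · refine not_conjugate_of_spin_lift hk hs hB hφ hψ fun h => ?_
    rw [signTwist_of_sign_eq_neg_one _ _ _ (sign_swap (by decide)), right_eq_mul] at h
    have h2 := congrArg (Subtype.val) h
    rw [hz] at h2
    exact Spin.one_ne_neg_one h2.symm
  · ext1 σ
    exact (hφ σ).trans (hψ σ).symm
  · refine Representation.Equiv.mk (hookTensorEquiv B k).symm fun σ => ?_
    change _ ∘ₗ spinCover _ (φ σ) = _
    rw [hφ]
    refine LinearMap.ext fun y => (hookTensorEquiv B k).injective ?_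
    have h := LinearMap.congr_fun (hookTensorEquiv_equivariant B k σ) ((hookTensorEquiv B k).symm y)
    simp only [LinearMap.comp_apply, LinearEquiv.coe_coe, LinearEquiv.apply_symm_apply] at h ⊢
    exact h.symm

end

end
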